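/- A curve is a differentiable function $f:[a,b]\to\mathbb C\cong\mathbb R^2$, $a<b$, whose derivative $f'$ is absolutely continuous and nowhere zero. With $ds=|f'(t)|\,dt$ the arclength element, its signed curvature is $\kappa=d\tau/ds=\operatorname{Im}(\overline{f'}f'')/|f'|^3$ (defined almost everywhere), where $\tau$ is an absolutely continuous direction angle, $f'=|f'|e^{i\tau}$. Its turning angle is $\int\kappa\,ds$ and its bending energy is $\frac14\int\kappa^2\,ds\in[0,\infty]$. A c-curve is a curve with $\kappa\ge 0$ almost everywhere (a left c-curve) or $\kappa\le 0$ almost everywhere (a right c-curve) whose turning angle has magnitude at most $\pi$. An s-curve is a curve that either is a c-curve or consists of a left c-curve followed by a right c-curve, or of a right c-curve followed by a left c-curve. Let $n\ge 2$ and let $P_1,\dots,P_n$ be points in the plane with $P_i\neq P_{i+1}$ for $1\le i<n$. Let $\mathcal A(P_1,\dots,P_n)$ be the family of admissible interpolating curves, that is, of curves $f:[a,b]\to\mathbb C$ for which there are $a=t_1<t_2<\dots<t_n=b$ such that $f(t_i)=P_i$ for all $i$ and each piece $f|_{[t_i,t_{i+1}]}$, $1\le i<n$, is an s-curve. **Theorem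 1.1.** The family $\mathcal A(P_1,\dots,P_n)$ contains a curve of minimal bending energy: there is $f\in\mathcal A(P_1,\dots,P_n)$ whose bending energy is finite and is at most the bending energy of every $g\in\mathcal A(P_1,\dots,P_n)$. -/

import Mathlib

/-- The restriction of `f : ℝ → ℂ` to `[a, b]`, `a < b`, is a curve: it is differentiable, and its
derivative (one-sided at the ends) is absolutely continuous and nowhere zero. -/
def IsCurve (f : ℝ → ℂ) (a b : ℝ) : Prop :=
  a < b ∧
  DifferentiableOn ℝ f (Set.Icc a b) ∧
  AbsolutelyContinuousOnInterval (derivWithin f (Set.Icc a b)) a b ∧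
  ∀ t ∈ Set.Icc a b, derivWithin f (Set.Icc a b) t ≠ 0

/-- The signed curvature at the parameter `t`, i.e. `Im (conj f' * f'') / |f'| ^ 3`. On a curve it
is defined for almost every `t`, and it is the derivative of the direction angle with respect to
arclength (see `signedCurvature_eq_of_directionAngle`). -/
noncomputable def signedCurvature (f : ℝ → ℂ) (t : ℝ) : ℝ :=
  ((starRingEnd ℂ) (deriv f t) * deriv (deriv f) t).im / ‖deriv f t‖ ^ 3

/-- If `f' = |f'| exp (i θ)` then the signed curvature is `dθ/ds`, where `ds = |f'| dt`. -/
theorem signedCurvature_eq_of_directionAngle {f : ℝ → ℂ} {θ : ℝ → ℝ} {t : ℝ}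
    (hne : deriv f t ≠ 0) (h2 : DifferentiableAt ℝ (deriv f) t) (hθ : DifferentiableAt ℝ θ t)
    (hf : ∀ᶠ x in nhds t, deriv f x = (‖deriv f x‖ : ℂ) * Complex.exp (Complex.I * (θ x : ℂ))) :
    signedCurvature f t = deriv θ t / ‖deriv f t‖ := by
  have hr : DifferentiableAt ℝ (fun x => ‖deriv f x‖) t := h2.norm ℝ hne
  have hpos : 0 < ‖deriv f t‖ := norm_pos_iff.mpr hne
  have hd := (hr.hasDerivAt.ofReal_comp).mul
    ((hθ.hasDerivAt.ofReal_comp.const_mul Complex.I).cexp)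
  have h1 := (hd.congr_of_eventuallyEq hf).deriv
  have h0 := hf.self_of_nhds
  have hE : (starRingEnd ℂ) (Complex.exp (Complex.I * (θ t : ℂ))) *
      Complex.exp (Complex.I * (θ t : ℂ)) = 1 := by
    rw [← Complex.exp_conj, ← Complex.exp_add]; simp
  have key : (starRingEnd ℂ) (deriv f t) * deriv (deriv f) t =
      ((‖deriv f t‖ * deriv (fun x => ‖deriv f x‖) t : ℝ) : ℂ) +
      ((‖deriv f t‖ ^ 2 * deriv θ t : ℝ) : ℂ) * Complex.I := by
    rw [h1]
    conv_lhs => rw [h0]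
    simp only [map_mul, Complex.conj_ofReal]
    push_cast
    generalize Complex.exp (Complex.I * (θ t : ℂ)) = e at *
    have hn : ‖(‖deriv f t‖ : ℂ) * e‖ = ‖deriv f t‖ := by rw [← h0]
    simp only [hn]
    linear_combination
      ((‖deriv f t‖ : ℂ) * ((deriv (fun x => ‖deriv f x‖) t : ℝ) : ℂ)
        + (‖deriv f t‖ : ℂ) ^ 2 * ((deriv θ t : ℝ) : ℂ) * Complex.I) * hE
  unfold signedCurvature
  rw [key]
  simp only [Complex.add_im, Complex.ofReal_im, Complex.mul_im, Complex.ofReal_re, Complex.I_im,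
    Complex.I_re]
  field_simp
  ring

/-- The turning angle `∫ κ ds` of the curve `f` on `[a, b]`, with `ds = |f'| dt`. -/
noncomputable def turningAngle (f : ℝ → ℂ) (a b : ℝ) : ℝ :=
  ∫ t in a..b, signedCurvature f t * ‖deriv f t‖

/-- The bending energy `(1/4) ∫ κ² ds` of the curve `f` on `[a, b]`, with value `∞` when `κ` is not
square integrable with respect to arclength. -/
noncomputable def bendingEnergy (f : ℝ → ℂ) (a b : ℝ) : ENNReal :=
  (1 / 4) * ∫⁻ t in Set.Icc a b, ENNReal.ofReal (signedCurvature f t ^ 2 * ‖deriv f t‖)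

/-- A left-curve: the signed curvature is nonnegative almost everywhere. -/
def IsLeftCurve (f : ℝ → ℂ) (a b : ℝ) : Prop :=
  IsCurve f a b ∧ ∀ᵐ t ∂(MeasureTheory.volume.restrict (Set.Icc a b)), 0 ≤ signedCurvature f t

/-- A right-curve: the signed curvature is nonpositive almost everywhere. -/
def IsRightCurve (f : ℝ → ℂ) (a b : ℝ) : Prop :=
  IsCurve f a b ∧ ∀ᵐ t ∂(MeasureTheory.volume.restrict (Set.Icc a b)), signedCurvature f t ≤ 0

/-- A left c-curve: a left-curve whose turning angle has magnitude at most `π`. -/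
def IsLeftCCurve (f : ℝ → ℂ) (a b : ℝ) : Prop :=
  IsLeftCurve f a b ∧ |turningAngle f a b| ≤ Real.pi

/-- A right c-curve: a right-curve whose turning angle has magnitude at most `π`. -/
def IsRightCCurve (f : ℝ → ℂ) (a b : ℝ) : Prop :=
  IsRightCurve f a b ∧ |turningAngle f a b| ≤ Real.pi

/-- An s-curve: a c-curve, or a curve consisting of a c-curve followed by a c-curve that turns in
the opposite direction. -/
def IsSCurve (f : ℝ → ℂ) (a b : ℝ) : Prop :=
  (IsLeftCCurve f a b ∨ IsRightCCurve f a b) ∨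
  (IsCurve f a b ∧ ∃ c ∈ Set.Ioo a b,
    (IsLeftCCurve f a c ∧ IsRightCCurve f c b) ∨ (IsRightCCurve f a c ∧ IsLeftCCurve f c b))

/-- Membership of the curve `f` on `[a, b]` in the family of admissible interpolating curves of
`P 0, …, P (n - 1)`: it passes through the points in order at times `a = t 0 < ⋯ < t (n - 1) = b`,
and each piece between consecutive times is an s-curve. -/
def IsAdmissible {n : ℕ} (P : Fin n → ℂ) (f : ℝ → ℂ) (a b : ℝ) : Prop :=
  IsCurve f a b ∧
  ∃ t : Fin n → ℝ, StrictMono t ∧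
    (∀ i : Fin n, (i : ℕ) = 0 → t i = a) ∧
    (∀ i : Fin n, (i : ℕ) + 1 = n → t i = b) ∧
    (∀ i : Fin n, f (t i) = P i) ∧
    ∀ i j : Fin n, (j : ℕ) = (i : ℕ) + 1 → IsSCurve f (t i) (t j)

/-! This is the direct method, and the difficulty is compactness. Bounded energy does not bound
length: a c-curve that turns by `π` may contain long straight stretches in opposite directions,
which cost nothing and cancel in the displacement.

Cut an s-curve where its curvature changes sign. Seen from the cut, both halves become, up to
reflection, left-turning arcs with a common initial direction, turnings `φ₁, φ₂ ≤ π` and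
displacements `W₁`, `W₂`; the endpoints of the s-curve constrain only the sum `W = W₁ + W₂`. If `ψ ≥
0` and `φᵢ + ψ ≤ π`, integrating `√(sin (θ + ψ))` against curvature and applying Cauchy-Schwarz
gives `(∑ ∫ √(sin (x + ψ)))² ≤ e * Im (exp (iψ) W)`, where `e` is the total square integral of
curvature (`IsArc.sq_add_integral_sqrt_sin_le`). Equality calls for curvature proportional to `√(sin
(θ + ψ))`, that is, for arcs of the rectangular elastica. When the larger turning is at least `π /
2`, some `ψ` makes two such arcs, if necessary with one line segment in a direction where the sine
vanishes, have total displacement `W` and length at most `65 * ‖W‖` (`exists_short_arcs`). For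
smaller turnings the length is already controlled. So every pair has a short replacement with the
same turnings and no more energy (`IsArc.exists_short`).

Once lengths are bounded, weak compactness in `L²` shows that arcs, and hence s-shaped pieces, are
closed under limits (`IsArc.of_tendsto`, `IsPiece.of_tendsto`). Energies enter as upper bounds, so
that lower semicontinuity suffices. The problem becomes finite-dimensional: minimize the sum of
piece energies over the tangent angles at the nodes and the energies of the pieces. A piece changes
the angle by at most `π` and the initial angle can be normalized, so sublevel sets are compact. They
are nonempty because a common direction `γ`, parallel to no chord, can be prescribed at all nodes.
An admissible curve of finite energy yields such a chain with the same energy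
(`IsAdmissible.exists_mem_chains`), and a chain yields an admissible curve with no more energy
(`exists_isAdmissible_of_chain`). -/

open MeasureTheory Set Filter Topology

/-! ### Planar paths determined by their curvature -/

/-- The tangent angle at arclength `s` of the planar path with curvature `K` and initial angle
`0`. -/
noncomputable def tangentAngle (K : ℝ → ℝ) (s : ℝ) : ℝ := ∫ x in (0 : ℝ)..s, K x

/-- The displacement, over `[0, L]`, of the arclength-parametrized planar path with curvature `K`
and initial tangent angle `0`. -/
noncomputable def displacement (K : ℝ → ℝ) (L : ℝ) : ℂ :=
  ∫ s in (0 : ℝ)..L, Complex.exp (tangentAngle K s * Complex.I)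

/-- There is a left-turning path of length `L`, initial tangent angle `0`, total turning `φ` and
displacement `W` whose curvature has square integral at most `e`. -/
def IsArc (L φ : ℝ) (W : ℂ) (e : ℝ) : Prop :=
  0 ≤ L ∧ ∃ K : ℝ → ℝ, MemLp K 2 volume ∧ (∀ᵐ s, 0 ≤ K s) ∧ tangentAngle K L = φ ∧
    displacement K L = W ∧ ∫ s, K s ^ 2 ≤ e

theorem MeasureTheory.MemLp.intervalIntegrable_real {K : ℝ → ℝ} (hK : MemLp K 2 volume) (a b : ℝ) :
    IntervalIntegrable K volume a b :=
  intervalIntegrable_iff.mpr <| ((hK.locallyIntegrable (by norm_num)).integrableOn_isCompact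
    isCompact_uIcc).mono_set uIoc_subset_uIcc

theorem continuous_tangentAngle {K : ℝ → ℝ} (hK : MemLp K 2 volume) :
    Continuous (tangentAngle K) :=
  intervalIntegral.continuous_primitive (fun a b => hK.intervalIntegrable_real a b) 0

theorem tangentAngle_sub {K : ℝ → ℝ} (hK : MemLp K 2 volume) (x y : ℝ) :
    tangentAngle K y - tangentAngle K x = ∫ s in x..y, K s :=
  intervalIntegral.integral_interval_sub_left (hK.intervalIntegrable_real _ _)
    (hK.intervalIntegrable_real _ _)

theorem tangentAngle_zero (K : ℝ → ℝ) : tangentAngle K 0 = 0 := by simp [tangentAngle]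

theorem monotone_tangentAngle {K : ℝ → ℝ} (hK : MemLp K 2 volume) (h0 : ∀ᵐ s, 0 ≤ K s) :
    Monotone (tangentAngle K) := by
  intro x y hxy
  have := intervalIntegral.integral_nonneg_of_ae hxy h0
  rw [← tangentAngle_sub hK] at this
  linarith

theorem continuous_tangent {K : ℝ → ℝ} (hK : MemLp K 2 volume) :
    Continuous fun s => Complex.exp (tangentAngle K s * Complex.I) := by
  have := continuous_tangentAngle hK
  fun_prop

theorem norm_displacement_le (K : ℝ → ℝ) {L : ℝ} (hL : 0 ≤ L) : ‖displacement K L‖ ≤ L := by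
  have := intervalIntegral.norm_integral_le_of_norm_le_const (a := (0 : ℝ)) (b := L)
    (f := fun s => Complex.exp (tangentAngle K s * Complex.I)) (C := 1)
    (fun x _ => by rw [Complex.norm_exp_ofReal_mul_I])
  simpa [displacement, abs_of_nonneg hL] using this

/-! ### Concatenation and reversal of paths -/

/-- The function equal to `K₁` on `(-∞, L]` followed by `K₂` shifted by `L`. -/
noncomputable def glue (L : ℝ) (K₁ K₂ : ℝ → ℝ) (s : ℝ) : ℝ := if s ≤ L then K₁ s else K₂ (s - L)

theorem glue_eq_indicator (L : ℝ) (K₁ K₂ : ℝ → ℝ) :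
    glue L K₁ K₂ = (Iic L).indicator K₁ + (Ioi L).indicator (fun s => K₂ (s - L)) := by
  ext s
  by_cases h : s ≤ L
  · simp [glue, h]
  · simp [glue, h, not_le.mp h]

theorem memLp_glue (L : ℝ) {K₁ K₂ : ℝ → ℝ} (h₁ : MemLp K₁ 2 volume) (h₂ : MemLp K₂ 2 volume) :
    MemLp (glue L K₁ K₂) 2 volume := by
  rw [glue_eq_indicator]
  exact (h₁.indicator measurableSet_Iic).add
    ((h₂.comp_measurePreserving (measurePreserving_sub_right volume L)).indicator measurableSet_Ioi)

/-- Only an inequality, because gluing discards `K₁` beyond `L` and `K₂` on the negative half-line.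
-/
theorem integral_sq_glue_le (L : ℝ) {K₁ K₂ : ℝ → ℝ} (h₁ : MemLp K₁ 2 volume)
    (h₂ : MemLp K₂ 2 volume) :
    ∫ s, glue L K₁ K₂ s ^ 2 ≤ (∫ s, K₁ s ^ 2) + ∫ s, K₂ s ^ 2 := by
  have h3 : ∫ s, K₂ s ^ 2 = ∫ s, K₂ (s - L) ^ 2 :=
    (integral_sub_right_eq_self (fun s => K₂ s ^ 2) L).symm
  have i2 : Integrable fun s => K₂ (s - L) ^ 2 :=
    (h₂.comp_measurePreserving (measurePreserving_sub_right volume L)).integrable_sq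
  rw [h3, ← integral_add h₁.integrable_sq i2]
  refine integral_mono (memLp_glue L h₁ h₂).integrable_sq (h₁.integrable_sq.add i2) fun s => ?_
  simp only [glue]
  split_ifs <;> nlinarith [sq_nonneg (K₁ s), sq_nonneg (K₂ (s - L))]

theorem tangentAngle_glue_of_le {L : ℝ} (K₁ K₂ : ℝ → ℝ) (hL : 0 ≤ L) {s : ℝ} (hs : s ≤ L) :
    tangentAngle (glue L K₁ K₂) s = tangentAngle K₁ s := by
  refine intervalIntegral.integral_congr fun x hx => ?_
  have : x ≤ L := hx.2.trans (sup_le hL hs)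
  simp [glue, this]

theorem tangentAngle_glue_add {L : ℝ} {K₁ K₂ : ℝ → ℝ} (h₁ : MemLp K₁ 2 volume)
    (h₂ : MemLp K₂ 2 volume) (hL : 0 ≤ L) {s : ℝ} (hs : 0 ≤ s) :
    tangentAngle (glue L K₁ K₂) (L + s) = tangentAngle K₁ L + tangentAngle K₂ s := by
  have h := tangentAngle_sub (memLp_glue L h₁ h₂) L (L + s)
  rw [tangentAngle_glue_of_le K₁ K₂ hL le_rfl] at h
  have h4 : ∫ x in L..(L + s), glue L K₁ K₂ x = ∫ x in L..(L + s), K₂ (x - L) := by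
    refine intervalIntegral.integral_congr_ae (ae_of_all _ fun x hx => ?_)
    rw [uIoc_of_le (by linarith)] at hx
    simp [glue, not_le.mpr hx.1]
  rw [h4, intervalIntegral.integral_comp_sub_right (fun x => K₂ x) L] at h
  simp only [sub_self, add_sub_cancel_left] at h
  simp only [tangentAngle] at h ⊢
  linarith

theorem displacement_glue_of_le {L : ℝ} (K₁ K₂ : ℝ → ℝ) (hL : 0 ≤ L) {s : ℝ} (hs : s ≤ L) :
    displacement (glue L K₁ K₂) s = displacement K₁ s := by
  refine intervalIntegral.integral_congr fun x hx => ?_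
  simp only [tangentAngle_glue_of_le K₁ K₂ hL (hx.2.trans (sup_le hL hs))]

theorem displacement_glue_add {L : ℝ} {K₁ K₂ : ℝ → ℝ} (h₁ : MemLp K₁ 2 volume)
    (h₂ : MemLp K₂ 2 volume) (hL : 0 ≤ L) {s : ℝ} (hs : 0 ≤ s) :
    displacement (glue L K₁ K₂) (L + s) = displacement K₁ L +
      Complex.exp (tangentAngle K₁ L * Complex.I) * displacement K₂ s := by
  have hc := continuous_tangent (memLp_glue L h₁ h₂)
  have h : displacement (glue L K₁ K₂) L + ∫ x in L..(L + s),
      Complex.exp (tangentAngle (glue L K₁ K₂) x * Complex.I) =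
      displacement (glue L K₁ K₂) (L + s) :=
    intervalIntegral.integral_add_adjacent_intervals (hc.intervalIntegrable _ _)
      (hc.intervalIntegrable _ _)
  rw [← h, displacement_glue_of_le K₁ K₂ hL le_rfl]
  congr 1
  have h4 : ∫ x in L..(L + s), Complex.exp (tangentAngle (glue L K₁ K₂) x * Complex.I) =
      ∫ x in (0 : ℝ)..s, Complex.exp (tangentAngle (glue L K₁ K₂) (L + x) * Complex.I) := by
    rw [intervalIntegral.integral_comp_add_left
      (fun x => Complex.exp (tangentAngle (glue L K₁ K₂) x * Complex.I)) L]
    simp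
  rw [h4, displacement, ← intervalIntegral.integral_const_mul]
  refine intervalIntegral.integral_congr fun x hx => ?_
  rw [uIcc_of_le hs] at hx
  simp only [tangentAngle_glue_add h₁ h₂ hL hx.1, ← Complex.exp_add]
  push_cast
  ring_nf

theorem IsArc.energy_nonneg {L φ e : ℝ} {W : ℂ} (h : IsArc L φ W e) : 0 ≤ e := by
  obtain ⟨-, K, -, -, -, -, he⟩ := h
  exact (integral_nonneg fun s => sq_nonneg _).trans he

theorem IsArc.turning_nonneg {L φ e : ℝ} {W : ℂ} (h : IsArc L φ W e) : 0 ≤ φ := by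
  obtain ⟨hL, K, hK, h0, hφ, -, -⟩ := h
  have := monotone_tangentAngle hK h0 hL
  rwa [tangentAngle_zero, hφ] at this

theorem IsArc.norm_le {L φ e : ℝ} {W : ℂ} (h : IsArc L φ W e) : ‖W‖ ≤ L := by
  obtain ⟨hL, K, -, -, -, rfl, -⟩ := h
  exact norm_displacement_le K hL

theorem isArc_line {L : ℝ} (hL : 0 ≤ L) : IsArc L 0 L 0 := by
  refine ⟨hL, fun _ => 0, MemLp.zero, by simp, by simp [tangentAngle], ?_, by simp⟩
  simp [displacement, tangentAngle]

/-- Concatenation of two left-turning paths. -/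
theorem IsArc.concat {L₁ L₂ φ₁ φ₂ e₁ e₂ : ℝ} {W₁ W₂ : ℂ} (h₁ : IsArc L₁ φ₁ W₁ e₁)
    (h₂ : IsArc L₂ φ₂ W₂ e₂) :
    IsArc (L₁ + L₂) (φ₁ + φ₂) (W₁ + Complex.exp (φ₁ * Complex.I) * W₂) (e₁ + e₂) := by
  obtain ⟨hL₁, K₁, hK₁, hn₁, rfl, rfl, he₁⟩ := h₁
  obtain ⟨hL₂, K₂, hK₂, hn₂, rfl, rfl, he₂⟩ := h₂
  refine ⟨by positivity, glue L₁ K₁ K₂, memLp_glue L₁ hK₁ hK₂, ?_,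
    tangentAngle_glue_add hK₁ hK₂ hL₁ hL₂, displacement_glue_add hK₁ hK₂ hL₁ hL₂,
    (integral_sq_glue_le L₁ hK₁ hK₂).trans (add_le_add he₁ he₂)⟩
  have h3 : ∀ᵐ s, 0 ≤ K₂ (s - L₁) :=
    (measurePreserving_sub_right volume L₁).quasiMeasurePreserving.ae hn₂
  filter_upwards [hn₁, h3] with s a b
  simp only [glue]
  split_ifs <;> assumption

/-- Traversing a left-turning path backwards and reflecting gives a left-turning path. -/
theorem IsArc.reverse {L φ e : ℝ} {W : ℂ} (h : IsArc L φ W e) :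
    IsArc L φ (Complex.exp (φ * Complex.I) * (starRingEnd ℂ) W) e := by
  obtain ⟨hL, K, hK, h0, rfl, rfl, he⟩ := h
  have hp := Measure.measurePreserving_sub_left volume L
  have hang : ∀ s, tangentAngle (fun x => K (L - x)) s = tangentAngle K L - tangentAngle K (L - s) := by
    intro s
    rw [tangentAngle_sub hK, tangentAngle, intervalIntegral.integral_comp_sub_left (fun x => K x) L,
      sub_zero]
  refine ⟨hL, fun s => K (L - s), hK.comp_measurePreserving hp, hp.quasiMeasurePreserving.ae h0,
    ?_, ?_, ?_⟩
  · simp [hang, tangentAngle_zero]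
  · have h1 : (starRingEnd ℂ) (displacement K L) =
        ∫ s in (0 : ℝ)..L, Complex.exp (-(tangentAngle K s * Complex.I)) := by
      rw [displacement, intervalIntegral.integral_of_le hL, intervalIntegral.integral_of_le hL,
        ← integral_conj]
      refine integral_congr_ae (ae_of_all _ fun s => ?_)
      simp [← Complex.exp_conj]
    rw [h1, ← intervalIntegral.integral_const_mul, displacement]
    simp only [hang]
    have h2 := intervalIntegral.integral_comp_sub_left (a := 0) (b := L)
      (fun s => Complex.exp (tangentAngle K L * Complex.I) *
        Complex.exp (-(tangentAngle K s * Complex.I))) L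
    simp only [sub_zero, sub_self] at h2
    rw [← h2]
    refine intervalIntegral.integral_congr fun x _ => ?_
    simp only [← Complex.exp_add]
    push_cast
    ring_nf
  · rwa [integral_sub_left_eq_self (fun s => K s ^ 2) volume L]

/-! ### Arclength reparametrization -/

/-- Arclength reparametrization of a left-turning path with speed `v` and angular speed `k`. -/
theorem isArc_of_speed_of_nonneg {a b : ℝ} (hab : a < b) {v k : ℝ → ℝ} (hv : ContinuousOn v (Ioo a b))
    (hpos : ∀ t ∈ Ioo a b, 0 < v t) (hvi : IntervalIntegrable v volume a b)
    (hki : IntervalIntegrable k volume a b) (hk : ∀ t, 0 ≤ k t)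
    (he : IntervalIntegrable (fun t => k t ^ 2 / v t) volume a b) :
    IsArc (∫ t in a..b, v t) (∫ t in a..b, k t)
      (∫ t in a..b, v t * Complex.exp ((∫ x in a..t, k x : ℝ) * Complex.I))
      (∫ t in a..b, k t ^ 2 / v t) := by
  set S : ℝ → ℝ := fun t => ∫ x in a..t, v x with hS
  have hSa : S a = 0 := by simp [hS]
  have hSc : ContinuousOn S (Icc a b) := by
    have := intervalIntegral.continuousOn_primitive_interval (f := v) (a := a) (b := b)
      (μ := volume) ((intervalIntegrable_iff_integrableOn_Icc_of_le hab.le).mp hvi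
        |>.mono_set (by rw [uIcc_of_le hab.le]))
    rwa [uIcc_of_le hab.le] at this
  have hSd : ∀ t ∈ Ioo a b, HasDerivAt S (v t) t := by
    intro t ht
    refine intervalIntegral.integral_hasDerivAt_right ?_ ?_ ?_
    · exact hvi.mono_set (by
        rw [uIcc_of_le hab.le, uIcc_of_le ht.1.le]; exact Icc_subset_Icc_right ht.2.le)
    · exact hv.stronglyMeasurableAtFilter isOpen_Ioo t ht
    · exact hv.continuousAt (Ioo_mem_nhds ht.1 ht.2)
  have hSm : StrictMonoOn S (Icc a b) := by
    refine strictMonoOn_of_deriv_pos (convex_Icc a b) hSc fun t ht => ?_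
    rw [interior_Icc] at ht
    rw [(hSd t ht).deriv]
    exact hpos t ht
  have hL : 0 ≤ S b := hSa ▸ hSm.monotoneOn (left_mem_Icc.mpr hab.le) (right_mem_Icc.mpr hab.le) hab.le
  set T : ℝ → ℝ := Function.invFunOn S (Icc a b) with hT
  have hTS : ∀ t ∈ Icc a b, T (S t) = t := fun t ht =>
    hSm.injOn.leftInvOn_invFunOn ht
  -- Curvature as a function of arclength, cut off to zero so that it is square integrable on the
  -- whole line.
  set K : ℝ → ℝ := (Icc 0 (S b)).indicator fun s => k (T s) / v (T s) with hK
  have hSmem : ∀ t ∈ Icc a b, S t ∈ Icc 0 (S b) := fun t ht =>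
    ⟨hSa ▸ hSm.monotoneOn (left_mem_Icc.mpr hab.le) ht ht.1,
      hSm.monotoneOn ht (right_mem_Icc.mpr hab.le) ht.2⟩
  have hKS : ∀ t ∈ Icc a b, K (S t) = k t / v t := by
    intro t ht
    rw [hK, indicator_of_mem (hSmem t ht), hTS t ht]
  have hnn : ∀ t ∈ Ioo a b, 0 ≤ v t := fun t ht => (hpos t ht).le
  have hkio : ∀ c ∈ Ioc a b, ∫ s in (0 : ℝ)..S c, K s = ∫ t in a..c, k t := by
    intro c hc
    have hsub : Ioo a c ⊆ Ioo a b := Ioo_subset_Ioo_right hc.2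
    have h := integral_Icc_deriv_smul_of_deriv_nonneg (g := K)
      (hSc.mono (Icc_subset_Icc_right hc.2)) (fun x hx => hSd x (hsub hx))
      (fun x hx => hnn x (hsub hx)) hc.1.le
    rw [hSa, integral_Icc_eq_integral_Ioc, integral_Icc_eq_integral_Ioc,
      ← intervalIntegral.integral_of_le (hSmem c (Ioc_subset_Icc_self hc)).1] at h
    rw [← h, intervalIntegral.integral_of_le hc.1.le, integral_Ioc_eq_integral_Ioo,
      integral_Ioc_eq_integral_Ioo]
    refine setIntegral_congr_fun measurableSet_Ioo fun t ht => ?_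
    simp only [hKS t (Ioo_subset_Icc_self (hsub ht)), smul_eq_mul]
    field_simp [(hpos t (hsub ht)).ne']
  have hang : ∀ c ∈ Icc a b, tangentAngle K (S c) = ∫ t in a..c, k t := by
    intro c hc
    rcases hc.1.eq_or_lt with rfl | h
    · simp [hSa, tangentAngle]
    · exact hkio c ⟨h, hc.2⟩
  have hcancel : ∀ t ∈ Ioo a b, v t • K (S t) = k t := by
    intro t ht
    have := (hpos t ht).ne'
    rw [hKS t (Ioo_subset_Icc_self ht), smul_eq_mul]
    field_simp
  have hcancel2 : ∀ t ∈ Ioo a b, v t • K (S t) ^ 2 = k t ^ 2 / v t := by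
    intro t ht
    have := (hpos t ht).ne'
    rw [hKS t (Ioo_subset_Icc_self ht), smul_eq_mul]
    field_simp
  have hiK : IntegrableOn K (Icc 0 (S b)) := by
    have h := integrableOn_Icc_deriv_smul_iff_of_deriv_nonneg (g := K) hSc hSd hnn hab.le
    rw [hSa] at h
    rw [← h, integrableOn_Icc_iff_integrableOn_Ioo]
    exact (integrableOn_congr_fun hcancel measurableSet_Ioo).mpr
      ((intervalIntegrable_iff_integrableOn_Ioo_of_le hab.le).mp hki)
  have hiK2 : IntegrableOn (fun s => K s ^ 2) (Icc 0 (S b)) := by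
    have h := integrableOn_Icc_deriv_smul_iff_of_deriv_nonneg (g := fun s => K s ^ 2)
      hSc hSd hnn hab.le
    rw [hSa] at h
    rw [← h, integrableOn_Icc_iff_integrableOn_Ioo]
    exact (integrableOn_congr_fun hcancel2 measurableSet_Ioo).mpr
      ((intervalIntegrable_iff_integrableOn_Ioo_of_le hab.le).mp he)
  have hKsupp : ∀ s ∉ Icc 0 (S b), K s = 0 := fun s hs => indicator_of_notMem hs _
  have hKint : Integrable K :=
    hiK.integrable_of_forall_notMem_eq_zero hKsupp
  have hK2 : Integrable fun s => K s ^ 2 :=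
    hiK2.integrable_of_forall_notMem_eq_zero fun s hs => by simp [hKsupp s hs]
  refine ⟨hL, K, (memLp_two_iff_integrable_sq hKint.1).mpr hK2, ?_,
    hang b (right_mem_Icc.mpr hab.le), ?_, le_of_eq ?_⟩
  -- The sign of `v` is known only inside `(a, b)`, since elastica speeds may degenerate at the
  -- ends; the two end arclengths form a null set.
  · filter_upwards [Measure.ae_ne volume 0, Measure.ae_ne volume (S b)] with s hs0 hsb
    by_cases hs : s ∈ Icc 0 (S b)
    · have hs' := hs
      rw [← hSa] at hs'
      obtain ⟨t, ht, rfl⟩ := intermediate_value_Icc hab.le hSc hs'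
      have hta : t ≠ a := by rintro rfl; exact hs0 hSa
      have htb : t ≠ b := by rintro rfl; exact hsb rfl
      rw [hKS t ht]
      exact div_nonneg (hk t) (hnn t ⟨lt_of_le_of_ne ht.1 hta.symm, lt_of_le_of_ne ht.2 htb⟩)
    · rw [hKsupp s hs]
  · have h := integral_Icc_deriv_smul_of_deriv_nonneg
      (g := fun s => Complex.exp (tangentAngle K s * Complex.I)) hSc hSd hnn hab.le
    rw [hSa, integral_Icc_eq_integral_Ioc, integral_Icc_eq_integral_Ioc,
      ← intervalIntegral.integral_of_le hL, ← intervalIntegral.integral_of_le hab.le] at h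
    rw [displacement, ← h]
    refine intervalIntegral.integral_congr fun t ht => ?_
    rw [uIcc_of_le hab.le] at ht
    simp only [hang t ht, Complex.real_smul]
  · have h := integral_Icc_deriv_smul_of_deriv_nonneg (g := fun s => K s ^ 2) hSc hSd hnn hab.le
    rw [hSa] at h
    rw [← setIntegral_eq_integral_of_forall_compl_eq_zero (s := Icc 0 (S b)), ← h,
      intervalIntegral.integral_of_le hab.le, integral_Icc_eq_integral_Ioo,
      integral_Ioc_eq_integral_Ioo]
    · exact setIntegral_congr_fun measurableSet_Ioo hcancel2
    · intro s hs
      simp [hKsupp s hs]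

/-- Replacing `k` by `|k|` changes none of the integrals, so nonnegativity almost everywhere
suffices. -/
theorem isArc_of_speed {a b : ℝ} (hab : a < b) {v k : ℝ → ℝ} (hv : ContinuousOn v (Ioo a b))
    (hpos : ∀ t ∈ Ioo a b, 0 < v t) (hvi : IntervalIntegrable v volume a b)
    (hki : IntervalIntegrable k volume a b) (hk : ∀ᵐ t, t ∈ Ioo a b → 0 ≤ k t)
    (he : IntervalIntegrable (fun t => k t ^ 2 / v t) volume a b) :
    IsArc (∫ t in a..b, v t) (∫ t in a..b, k t)
      (∫ t in a..b, v t * Complex.exp ((∫ x in a..t, k x : ℝ) * Complex.I))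
      (∫ t in a..b, k t ^ 2 / v t) := by
  have heq : ∀ᵐ t, t ∈ Ioo a b → |k t| = k t := by
    filter_upwards [hk] with t ht h using abs_of_nonneg (ht h)
  have hint : ∀ t ∈ Icc a b, ∫ x in a..t, |k x| = ∫ x in a..t, k x := by
    intro t ht
    refine intervalIntegral.integral_congr_ae ?_
    filter_upwards [heq, Measure.ae_ne volume b] with x hx hxb hxt
    rw [uIoc_of_le ht.1] at hxt
    exact hx ⟨hxt.1, lt_of_le_of_ne (hxt.2.trans ht.2) hxb⟩
  have h := isArc_of_speed_of_nonneg hab hv hpos hvi hki.abs (fun t => abs_nonneg (k t))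
    (by simpa only [sq_abs] using he)
  simp only [sq_abs] at h
  rw [hint b (right_mem_Icc.mpr hab.le)] at h
  convert h using 1
  refine intervalIntegral.integral_congr fun t ht => ?_
  rw [uIcc_of_le hab.le] at ht
  simp only [hint t ht]

theorem LipschitzWith.comp_absolutelyContinuousOnInterval {X Y : Type*} [PseudoMetricSpace X]
    [PseudoMetricSpace Y] {C : NNReal} {g : X → Y} (hg : LipschitzWith C g) {f : ℝ → X} {a b : ℝ}
    (hf : AbsolutelyContinuousOnInterval f a b) :
    AbsolutelyContinuousOnInterval (fun x => g (f x)) a b := by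
  unfold AbsolutelyContinuousOnInterval at hf ⊢
  have h := hf.const_mul (C : ℝ)
  rw [mul_zero] at h
  refine squeeze_zero (fun E => Finset.sum_nonneg fun i _ => dist_nonneg) (fun E => ?_) h
  rw [Finset.mul_sum]
  exact Finset.sum_le_sum fun i _ => hg.dist_le_mul _ _

/-! ### The Cauchy-Schwarz lower bound -/

/-- The projection of the displacement to a direction, as an integral of sines. -/
theorem im_exp_mul_displacement {K : ℝ → ℝ} (hK : MemLp K 2 volume) (L ψ : ℝ) :
    (Complex.exp (ψ * Complex.I) * displacement K L).im =
      ∫ s in (0 : ℝ)..L, Real.sin (tangentAngle K s + ψ) := by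
  have hc := continuous_tangent hK
  rw [displacement, ← intervalIntegral.integral_const_mul]
  have h := Complex.imCLM.intervalIntegral_comp_comm (μ := volume) (a := 0) (b := L)
    (f := fun s => Complex.exp (ψ * Complex.I) * Complex.exp (tangentAngle K s * Complex.I))
    ((continuous_const.mul hc).intervalIntegrable _ _)
  simp only [Complex.imCLM_apply] at h
  rw [← h]
  refine intervalIntegral.integral_congr fun s _ => ?_
  simp only [← Complex.exp_add]
  rw [← add_mul, ← Complex.ofReal_add, Complex.exp_ofReal_mul_I_im, add_comm]

theorem hasDerivAt_integral_sqrt_sin (ψ x : ℝ) :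
    HasDerivAt (fun x => ∫ t in (0 : ℝ)..x, √(Real.sin (t + ψ))) (√(Real.sin (x + ψ))) x := by
  have hc : Continuous fun t => √(Real.sin (t + ψ)) := by fun_prop
  exact intervalIntegral.integral_hasDerivAt_right (hc.intervalIntegrable _ _)
    (hc.stronglyMeasurableAtFilter _ _) hc.continuousAt

theorem lipschitzWith_integral_sqrt_sin (ψ : ℝ) :
    LipschitzWith 1 fun x => ∫ t in (0 : ℝ)..x, √(Real.sin (t + ψ)) := by
  refine lipschitzWith_of_nnnorm_deriv_le
    (fun x => (hasDerivAt_integral_sqrt_sin ψ x).differentiableAt) fun x => ?_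
  rw [(hasDerivAt_integral_sqrt_sin ψ x).deriv, ← NNReal.coe_le_coe, coe_nnnorm,
    Real.norm_of_nonneg (Real.sqrt_nonneg _)]
  exact Real.sqrt_le_one.mpr (Real.sin_le_one _)

theorem MeasureTheory.MemLp.absolutelyContinuous_tangentAngle {K : ℝ → ℝ} (hK : MemLp K 2 volume)
    {a b : ℝ} : AbsolutelyContinuousOnInterval (tangentAngle K) a b := by
  have h := (hK.intervalIntegrable_real a b).absolutelyContinuousOnInterval_intervalIntegral
    (c := a) left_mem_uIcc
  have h2 : tangentAngle K = fun x => tangentAngle K a + ∫ v in a..x, K v := by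
    ext x
    rw [← tangentAngle_sub hK]
    ring
  rw [h2]
  refine AbsolutelyContinuousOnInterval.fun_add ?_ h
  exact (LipschitzWith.const (tangentAngle K a)).lipschitzOnWith.absolutelyContinuousOnInterval

theorem ae_hasDerivAt_tangentAngle {K : ℝ → ℝ} (hK : MemLp K 2 volume) :
    ∀ᵐ s, HasDerivAt (tangentAngle K) (K s) s := by
  filter_upwards [LocallyIntegrable.ae_hasDerivAt_integral (hK.locallyIntegrable (by norm_num))]
    with s hs using hs 0

/-- After rotation by `ψ` the tangent angles stay in `[ψ, φ + ψ] ⊆ [0, π]`, so the path never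
descends. -/
theorem IsArc.im_exp_mul_nonneg {L φ e ψ : ℝ} {W : ℂ} (h : IsArc L φ W e) (hψ : 0 ≤ ψ)
    (hφ : φ + ψ ≤ Real.pi) : 0 ≤ (Complex.exp (ψ * Complex.I) * W).im := by
  obtain ⟨hL, K, hK, h0, rfl, rfl, -⟩ := h
  rw [im_exp_mul_displacement hK]
  refine intervalIntegral.integral_nonneg hL fun s hs => ?_
  have h1 := monotone_tangentAngle hK h0 hs.1
  have h2 := monotone_tangentAngle hK h0 hs.2
  rw [tangentAngle_zero] at h1
  exact Real.sin_nonneg_of_nonneg_of_le_pi (by linarith) (by linarith)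

/-- The Cauchy-Schwarz lower bound for the bending energy of a left-turning path. -/
theorem IsArc.sq_integral_sqrt_sin_le {L φ e ψ : ℝ} {W : ℂ} (h : IsArc L φ W e) (hψ : 0 ≤ ψ)
    (hφ : φ + ψ ≤ Real.pi) :
    (∫ x in (0 : ℝ)..φ, √(Real.sin (x + ψ))) ^ 2 ≤ e * (Complex.exp (ψ * Complex.I) * W).im := by
  obtain ⟨hL, K, hK, h0, rfl, rfl, he⟩ := h
  have hΘ := continuous_tangentAngle hK
  have hnn : ∀ s ∈ Icc 0 L, 0 ≤ Real.sin (tangentAngle K s + ψ) := by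
    intro s hs
    have h1 := monotone_tangentAngle hK h0 hs.1
    have h2 := monotone_tangentAngle hK h0 hs.2
    rw [tangentAngle_zero] at h1
    exact Real.sin_nonneg_of_nonneg_of_le_pi (by linarith) (by linarith)
  set w : ℝ → ℝ := fun s => √(Real.sin (tangentAngle K s + ψ)) with hw
  have hwc : Continuous w := by fun_prop
  -- A Lipschitz primitive of `√(sin (x + ψ))` composed with the absolutely continuous tangent angle
  -- is absolutely continuous, so the fundamental theorem turns `∫ w * K` into an integral over
  -- angles that depends only on the total turning.
  have hac := (lipschitzWith_integral_sqrt_sin ψ).comp_absolutelyContinuousOnInterval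
    (hK.absolutelyContinuous_tangentAngle (a := 0) (b := L))
  have hH := hac.integral_deriv_eq_sub
  simp only [tangentAngle_zero, intervalIntegral.integral_same, sub_zero] at hH
  have hH' : ∫ s in (0 : ℝ)..L, w s * K s =
      ∫ x in (0 : ℝ)..tangentAngle K L, √(Real.sin (x + ψ)) := by
    rw [← hH]
    refine intervalIntegral.integral_congr_ae ?_
    filter_upwards [ae_hasDerivAt_tangentAngle hK] with s hs _
    exact ((hasDerivAt_integral_sqrt_sin ψ _).comp s hs).deriv.symm
  have hy : ∫ s in (0 : ℝ)..L, w s ^ 2 = (Complex.exp (ψ * Complex.I) * displacement K L).im := by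
    rw [im_exp_mul_displacement hK]
    refine intervalIntegral.integral_congr fun s hs => ?_
    rw [uIcc_of_le hL] at hs
    exact Real.sq_sqrt (hnn s hs)
  have hK2 : IntervalIntegrable (fun s => K s ^ 2) volume 0 L :=
    hK.integrable_sq.intervalIntegrable
  have hKe : ∫ s in (0 : ℝ)..L, K s ^ 2 ≤ e := by
    rw [intervalIntegral.integral_of_le hL]
    exact (setIntegral_le_integral hK.integrable_sq (ae_of_all _ fun s => sq_nonneg _)).trans he
  rw [← hH', ← hy]
  -- Cauchy-Schwarz by way of the discriminant of `∫ (x w - K)²`, a quadratic in `x`.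
  have hq : ∀ x : ℝ, 0 ≤ (∫ s in (0 : ℝ)..L, w s ^ 2) * (x * x) +
      (-2 * ∫ s in (0 : ℝ)..L, w s * K s) * x + e := by
    intro x
    have h1 : 0 ≤ ∫ s in (0 : ℝ)..L, (x * w s - K s) ^ 2 :=
      intervalIntegral.integral_nonneg hL fun s _ => sq_nonneg _
    have h2 : ∀ s, (x * w s - K s) ^ 2 = x ^ 2 * w s ^ 2 - 2 * x * (w s * K s) + K s ^ 2 :=
      fun s => by ring
    have i1 : IntervalIntegrable (fun s => x ^ 2 * w s ^ 2) volume 0 L :=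
      (by fun_prop : Continuous fun s => x ^ 2 * w s ^ 2).intervalIntegrable _ _
    have i2 : IntervalIntegrable (fun s => 2 * x * (w s * K s)) volume 0 L :=
      ((hK.intervalIntegrable_real 0 L).continuousOn_mul hwc.continuousOn).const_mul _
    simp only [h2] at h1
    rw [intervalIntegral.integral_add (i1.sub i2) hK2, intervalIntegral.integral_sub i1 i2,
      intervalIntegral.integral_const_mul, intervalIntegral.integral_const_mul] at h1
    nlinarith
  have hd := discrim_le_zero hq
  rw [discrim] at hd
  nlinarith

/-- The Cauchy-Schwarz lower bound for a pair of left-turning paths. -/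
theorem IsArc.sq_add_integral_sqrt_sin_le {L₁ L₂ φ₁ φ₂ e₁ e₂ ψ : ℝ} {W₁ W₂ : ℂ}
    (h₁ : IsArc L₁ φ₁ W₁ e₁) (h₂ : IsArc L₂ φ₂ W₂ e₂) (hψ : 0 ≤ ψ) (hφ₁ : φ₁ + ψ ≤ Real.pi)
    (hφ₂ : φ₂ + ψ ≤ Real.pi) :
    ((∫ x in (0 : ℝ)..φ₁, √(Real.sin (x + ψ))) + ∫ x in (0 : ℝ)..φ₂, √(Real.sin (x + ψ))) ^ 2 ≤
      (e₁ + e₂) * (Complex.exp (ψ * Complex.I) * (W₁ + W₂)).im := by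
  have b₁ := h₁.sq_integral_sqrt_sin_le hψ hφ₁
  have b₂ := h₂.sq_integral_sqrt_sin_le hψ hφ₂
  have p₁ := h₁.energy_nonneg
  have p₂ := h₂.energy_nonneg
  have n₁ := h₁.im_exp_mul_nonneg hψ hφ₁
  have n₂ := h₂.im_exp_mul_nonneg hψ hφ₂
  rw [mul_add, Complex.add_im]
  set A := ∫ x in (0 : ℝ)..φ₁, √(Real.sin (x + ψ))
  set B := ∫ x in (0 : ℝ)..φ₂, √(Real.sin (x + ψ))
  set y₁ := (Complex.exp (ψ * Complex.I) * W₁).im with hy₁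
  set y₂ := (Complex.exp (ψ * Complex.I) * W₂).im with hy₂
  have hs : 0 ≤ e₁ * y₂ + e₂ * y₁ := by positivity
  -- From `A² ≤ e₁ y₁` and `B² ≤ e₂ y₂` by the inequality of arithmetic and geometric means: `4 A²
  -- B² ≤ 4 (e₁ y₂) (e₂ y₁) ≤ (e₁ y₂ + e₂ y₁)²`.
  have key : 2 * (A * B) ≤ e₁ * y₂ + e₂ * y₁ := by
    refine le_of_not_gt fun hlt => ?_
    have h3 : A ^ 2 * B ^ 2 ≤ e₁ * y₁ * (e₂ * y₂) :=
      mul_le_mul b₁ b₂ (sq_nonneg _) ((sq_nonneg A).trans b₁)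
    nlinarith [sq_nonneg (e₁ * y₂ - e₂ * y₁)]
  nlinarith

/-! ### Uniform integrability of the elastica's radius of curvature -/

/-- The distances from `x + ψ` to `0` and to `π` are at least `x` and `φ₀ - x`, and the sine is at
least a quarter of the distance to the nearer one. The bound is free of `ψ`, so it dominates the
whole family. -/
theorem inv_sqrt_sin_le {φ₀ ψ x : ℝ} (hψ : ψ ∈ Icc 0 (Real.pi - φ₀)) (hx : x ∈ Ioo 0 φ₀) :
    (√(Real.sin (x + ψ)))⁻¹ ≤ 2 * ((√x)⁻¹ + (√(φ₀ - x))⁻¹) := by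
  obtain ⟨hψ0, hψ1⟩ := hψ
  obtain ⟨hx0, hx1⟩ := hx
  have hpi := Real.pi_lt_four
  have hpi0 := Real.pi_pos
  have key : ∀ y z : ℝ, 0 < y → y ≤ z → z ≤ Real.pi / 2 → (√(Real.sin z))⁻¹ ≤ 2 * (√y)⁻¹ := by
    intro y z hy hyz hz
    have h1 : y / 4 ≤ Real.sin z := by
      have h2 := Real.mul_le_sin (hy.le.trans hyz) hz
      have h3 : y / 4 ≤ 2 / Real.pi * z := by
        rw [div_mul_eq_mul_div, div_le_div_iff₀ (by norm_num) hpi0]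
        nlinarith
      linarith
    have h4 : √y / 2 ≤ √(Real.sin z) := by
      apply Real.le_sqrt_of_sq_le
      rw [div_pow, Real.sq_sqrt hy.le]
      linarith
    have h5 : 0 < √y := Real.sqrt_pos.mpr hy
    calc (√(Real.sin z))⁻¹ ≤ (√y / 2)⁻¹ := inv_anti₀ (by positivity) h4
      _ = 2 * (√y)⁻¹ := by field_simp
  have p1 : 0 ≤ (√x)⁻¹ := by positivity
  have p2 : 0 ≤ (√(φ₀ - x))⁻¹ := by positivity
  rcases le_total (x + ψ) (Real.pi / 2) with h | h
  · have := key x (x + ψ) hx0 (by linarith) h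
    linarith
  · have := key (φ₀ - x) (Real.pi - (x + ψ)) (by linarith) (by linarith) (by linarith)
    rw [Real.sin_pi_sub] at this
    linarith

theorem inv_sqrt_eq_rpow {x : ℝ} (hx : 0 ≤ x) : (√x)⁻¹ = x ^ (-(1 / 2) : ℝ) := by
  rw [Real.sqrt_eq_rpow, Real.rpow_neg hx]

theorem intervalIntegrable_inv_sqrt (c : ℝ) : IntervalIntegrable (fun x => (√x)⁻¹) volume 0 c := by
  rcases le_total 0 c with h | h
  · refine (intervalIntegral.intervalIntegrable_rpow' (r := -(1 / 2)) (by norm_num)).congr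
      fun x hx => ?_
    rw [uIoc_of_le h] at hx
    exact (inv_sqrt_eq_rpow hx.1.le).symm
  · refine (IntervalIntegrable.zero (μ := volume)).congr fun x hx => ?_
    rw [uIoc_of_ge h] at hx
    simp [Real.sqrt_eq_zero_of_nonpos hx.2]

theorem integral_inv_sqrt {c : ℝ} (hc : 0 ≤ c) : ∫ x in (0 : ℝ)..c, (√x)⁻¹ = 2 * √c := by
  have h : ∫ x in (0 : ℝ)..c, (√x)⁻¹ = ∫ x in (0 : ℝ)..c, x ^ (-(1 / 2) : ℝ) := by
    refine intervalIntegral.integral_congr fun x hx => ?_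
    rw [uIcc_of_le hc] at hx
    exact inv_sqrt_eq_rpow hx.1
  rw [h, integral_rpow (Or.inl (by norm_num)), Real.sqrt_eq_rpow]
  norm_num
  ring

theorem intervalIntegrable_inv_sqrt_add (c : ℝ) :
    IntervalIntegrable (fun x => 2 * ((√x)⁻¹ + (√(c - x))⁻¹)) volume 0 c := by
  refine ((intervalIntegrable_inv_sqrt c).add ?_).const_mul 2
  have := (intervalIntegrable_inv_sqrt c).comp_sub_left c
  simpa using this.symm

/-- Each of the two terms integrates to `2 * √c`, giving `8 * √c ≤ 16`; the case `c ≤ 4` covers all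
angles up to `π`. -/
theorem integral_inv_sqrt_add_le {c : ℝ} (hc : 0 ≤ c) (hc4 : c ≤ 4) :
    ∫ x in (0 : ℝ)..c, 2 * ((√x)⁻¹ + (√(c - x))⁻¹) ≤ 16 := by
  have h1 := intervalIntegrable_inv_sqrt c
  have h2 : IntervalIntegrable (fun x => (√(c - x))⁻¹) volume 0 c := by
    simpa using (h1.comp_sub_left c).symm
  have h3 : ∫ x in (0 : ℝ)..c, (√(c - x))⁻¹ = ∫ x in (0 : ℝ)..c, (√x)⁻¹ := by
    simpa using intervalIntegral.integral_comp_sub_left (a := 0) (b := c) (fun x => (√x)⁻¹) c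
  rw [intervalIntegral.integral_const_mul, intervalIntegral.integral_add h1 h2, h3,
    integral_inv_sqrt hc]
  have : √c ≤ 2 := Real.sqrt_le_iff.mpr ⟨by norm_num, by linarith⟩
  linarith

theorem sin_add_pos {φ₀ ψ x : ℝ} (hψ : ψ ∈ Icc 0 (Real.pi - φ₀)) (hx : x ∈ Ioo 0 φ₀) :
    0 < Real.sin (x + ψ) :=
  Real.sin_pos_of_pos_of_lt_pi (by linarith [hψ.1, hx.1]) (by linarith [hψ.2, hx.2])

theorem intervalIntegrable_inv_sqrt_sin {φ₀ φ ψ : ℝ} (hφ : φ ∈ Icc 0 φ₀)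
    (hψ : ψ ∈ Icc 0 (Real.pi - φ₀)) :
    IntervalIntegrable (fun x => (√(Real.sin (x + ψ)))⁻¹) volume 0 φ := by
  have h0 : 0 ≤ φ₀ := hφ.1.trans hφ.2
  have h : IntervalIntegrable (fun x => (√(Real.sin (x + ψ)))⁻¹) volume 0 φ₀ := by
    refine (intervalIntegrable_inv_sqrt_add φ₀).mono_fun'
      (by fun_prop : Measurable fun x => (√(Real.sin (x + ψ)))⁻¹).aestronglyMeasurable ?_
    rw [uIoc_of_le h0, ← restrict_Ioo_eq_restrict_Ioc]
    filter_upwards [ae_restrict_mem measurableSet_Ioo] with x hx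
    rw [Real.norm_of_nonneg (by positivity)]
    exact inv_sqrt_sin_le hψ hx
  exact h.mono_set (by rw [uIcc_of_le hφ.1, uIcc_of_le h0]; exact Icc_subset_Icc_right hφ.2)

theorem integral_inv_sqrt_sin_le {φ₀ φ ψ : ℝ} (hφ : φ ∈ Icc 0 φ₀) (hπ : φ₀ ≤ Real.pi)
    (hψ : ψ ∈ Icc 0 (Real.pi - φ₀)) :
    ∫ x in (0 : ℝ)..φ, (√(Real.sin (x + ψ)))⁻¹ ≤ 16 := by
  have h0 : 0 ≤ φ₀ := hφ.1.trans hφ.2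
  refine le_trans ?_ (integral_inv_sqrt_add_le h0 (hπ.trans Real.pi_le_four))
  have h1 : ∫ x in (0 : ℝ)..φ, (√(Real.sin (x + ψ)))⁻¹ ≤
      ∫ x in (0 : ℝ)..φ₀, (√(Real.sin (x + ψ)))⁻¹ :=
    intervalIntegral.integral_mono_interval le_rfl hφ.1 hφ.2
      (ae_of_all _ fun x => by simp only [Pi.zero_apply]; positivity)
      (intervalIntegrable_inv_sqrt_sin (right_mem_Icc.mpr h0) hψ)
  refine h1.trans ?_
  rw [intervalIntegral.integral_of_le h0, intervalIntegral.integral_of_le h0,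
    integral_Ioc_eq_integral_Ioo, integral_Ioc_eq_integral_Ioo]
  exact setIntegral_mono_on
    ((intervalIntegrable_iff_integrableOn_Ioo_of_le h0).mp
      (intervalIntegrable_inv_sqrt_sin (right_mem_Icc.mpr h0) hψ))
    ((intervalIntegrable_iff_integrableOn_Ioo_of_le h0).mp (intervalIntegrable_inv_sqrt_add φ₀))
    measurableSet_Ioo fun x hx => inv_sqrt_sin_le hψ hx

/-! ### Rectangular elastica arcs and equality in the lower bound -/

/-- The displacement of the left-turning path that runs through the tangent angles from `0` to `φ`
with radius of curvature `1 / √(sin (x + ψ))` at the angle `x`. -/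
noncomputable def elasticaDisplacement (φ ψ : ℝ) : ℂ :=
  ∫ x in (0 : ℝ)..φ, ((√(Real.sin (x + ψ)))⁻¹ : ℝ) * Complex.exp (x * Complex.I)

/-- Parametrize by the tangent angle: angular speed `1` and speed `c / √(sin (x + ψ))` make the
curvature `√(sin (x + ψ)) / c`. The factor `c` is a dilation. -/
theorem isArc_elastica {φ₀ φ ψ c : ℝ} (hφ : φ ∈ Icc 0 φ₀) (hψ : ψ ∈ Icc 0 (Real.pi - φ₀))
    (hc : 0 < c) :
    IsArc (c * ∫ x in (0 : ℝ)..φ, (√(Real.sin (x + ψ)))⁻¹) φ (c * elasticaDisplacement φ ψ)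
      ((∫ x in (0 : ℝ)..φ, √(Real.sin (x + ψ))) / c) := by
  rcases hφ.1.eq_or_lt with rfl | hpos
  · simpa [elasticaDisplacement] using isArc_line le_rfl
  have hs : ∀ x ∈ Ioo 0 φ, 0 < Real.sin (x + ψ) := fun x hx =>
    sin_add_pos hψ ⟨hx.1, hx.2.trans_le hφ.2⟩
  have hcont : Continuous fun x => √(Real.sin (x + ψ)) := by fun_prop
  have h := isArc_of_speed (a := 0) (b := φ) (v := fun x => c * (√(Real.sin (x + ψ)))⁻¹)
    (k := fun _ => 1) hpos
    (continuousOn_const.mul (hcont.continuousOn.inv₀ fun x hx => (Real.sqrt_pos.mpr (hs x hx)).ne'))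
    (fun x hx => mul_pos hc (inv_pos.mpr (Real.sqrt_pos.mpr (hs x hx))))
    ((intervalIntegrable_inv_sqrt_sin hφ hψ).const_mul c)
    intervalIntegrable_const (ae_of_all _ fun _ _ => zero_le_one)
    (by
      have : (fun x => (1 : ℝ) ^ 2 / (c * (√(Real.sin (x + ψ)))⁻¹)) =
          fun x => √(Real.sin (x + ψ)) / c := by
        ext x
        rw [one_pow, one_div, mul_inv, inv_inv]
        ring
      rw [this]
      exact (hcont.div_const c).intervalIntegrable _ _)
  have e1 : ∀ x, (1 : ℝ) ^ 2 / (c * (√(Real.sin (x + ψ)))⁻¹) = √(Real.sin (x + ψ)) / c := by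
    intro x
    rw [one_pow, one_div, mul_inv, inv_inv]
    ring
  simp only [e1, intervalIntegral.integral_const_mul, intervalIntegral.integral_div,
    intervalIntegral.integral_const, sub_zero, smul_eq_mul, mul_one, Complex.ofReal_mul,
    mul_assoc] at h
  exact h

/-- Since `sin / √sin = √sin`, the height of the arc is the very integral that appears in the lower
bound; this is the case of equality. -/
theorem im_exp_mul_elasticaDisplacement {φ₀ φ ψ : ℝ} (hφ : φ ∈ Icc 0 φ₀)
    (hψ : ψ ∈ Icc 0 (Real.pi - φ₀)) :
    (Complex.exp (ψ * Complex.I) * elasticaDisplacement φ ψ).im =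
      ∫ x in (0 : ℝ)..φ, √(Real.sin (x + ψ)) := by
  have hr : IntervalIntegrable (fun x : ℝ => (((√(Real.sin (x + ψ)))⁻¹ : ℝ) : ℂ)) volume 0 φ := by
    have := intervalIntegrable_inv_sqrt_sin hφ hψ
    exact ⟨this.1.ofReal, this.2.ofReal⟩
  have hi : IntervalIntegrable (fun x : ℝ => (((√(Real.sin (x + ψ)))⁻¹ : ℝ) : ℂ) *
      Complex.exp (x * Complex.I)) volume 0 φ := hr.mul_continuousOn (by fun_prop)
  rw [elasticaDisplacement, ← intervalIntegral.integral_const_mul]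
  have h := Complex.imCLM.intervalIntegral_comp_comm (hi.const_mul (Complex.exp (ψ * Complex.I)))
  simp only [Complex.imCLM_apply] at h
  rw [← h]
  refine intervalIntegral.integral_congr fun x _ => ?_
  have : Complex.exp (ψ * Complex.I) * ((((√(Real.sin (x + ψ)))⁻¹ : ℝ) : ℂ) *
      Complex.exp (x * Complex.I)) = (((√(Real.sin (x + ψ)))⁻¹ : ℝ) : ℂ) *
      Complex.exp ((x + ψ : ℝ) * Complex.I) := by
    push_cast
    rw [add_mul, Complex.exp_add]
    ring
  simp only [this]
  rw [Complex.im_ofReal_mul, Complex.exp_ofReal_mul_I_im, mul_comm, ← div_eq_mul_inv,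
    Real.div_sqrt]

theorem continuousOn_elasticaDisplacement {φ₀ φ : ℝ} (hφ : φ ∈ Icc 0 φ₀) :
    ContinuousOn (elasticaDisplacement φ) (Icc 0 (Real.pi - φ₀)) := by
  intro ψ hψ
  refine intervalIntegral.continuousWithinAt_of_dominated_interval
    (bound := fun x => 2 * ((√x)⁻¹ + (√(φ₀ - x))⁻¹)) ?_ ?_ ?_ ?_
  · refine Eventually.of_forall fun ψ => ?_
    exact (by fun_prop : Measurable fun x : ℝ => (((√(Real.sin (x + ψ)))⁻¹ : ℝ) : ℂ) *
      Complex.exp (x * Complex.I)).aestronglyMeasurable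
  · filter_upwards [self_mem_nhdsWithin] with ψ hψ
    filter_upwards [Measure.ae_ne volume φ] with x hx hx'
    rw [uIoc_of_le hφ.1] at hx'
    rw [norm_mul, Complex.norm_exp_ofReal_mul_I, mul_one, Complex.norm_real,
      Real.norm_of_nonneg (by positivity)]
    exact inv_sqrt_sin_le hψ ⟨hx'.1, (lt_of_le_of_ne hx'.2 hx).trans_le hφ.2⟩
  · refine (intervalIntegrable_inv_sqrt_add φ₀).mono_set ?_
    rw [uIcc_of_le hφ.1, uIcc_of_le (hφ.1.trans hφ.2)]
    exact Icc_subset_Icc_right hφ.2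
  · filter_upwards [Measure.ae_ne volume φ] with x hx hx'
    rw [uIoc_of_le hφ.1] at hx'
    have hs := sin_add_pos hψ ⟨hx'.1, (lt_of_le_of_ne hx'.2 hx).trans_le hφ.2⟩
    have : ContinuousAt (fun ψ => (√(Real.sin (x + ψ)))⁻¹) ψ :=
      ContinuousAt.inv₀ (by fun_prop) (Real.sqrt_pos.mpr hs).ne'
    exact ((Complex.continuous_ofReal.continuousAt.comp this).mul
      continuousAt_const).continuousWithinAt

theorem continuous_integral_sqrt_sin (φ : ℝ) :
    Continuous fun ψ => ∫ x in (0 : ℝ)..φ, √(Real.sin (x + ψ)) :=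
  intervalIntegral.continuous_parametric_intervalIntegral_of_continuous' (by fun_prop) 0 φ

theorem integral_sqrt_sin_nonneg {φ : ℝ} (hφ : 0 ≤ φ) (ψ : ℝ) :
    0 ≤ ∫ x in (0 : ℝ)..φ, √(Real.sin (x + ψ)) :=
  intervalIntegral.integral_nonneg hφ fun _ _ => Real.sqrt_nonneg _

/-- On `[0, 1]` the square root dominates the identity, and `∫ sin (x + ψ) = cos ψ + cos (π - φ₀ -
ψ) ≥ cos ψ + sin ψ ≥ 1`, because `π - φ₀ ≤ π / 2`. -/
theorem one_le_integral_sqrt_sin {φ₀ ψ : ℝ} (h0 : Real.pi / 2 ≤ φ₀)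
    (hψ : ψ ∈ Icc 0 (Real.pi - φ₀)) : 1 ≤ ∫ x in (0 : ℝ)..φ₀, √(Real.sin (x + ψ)) := by
  have hpi := Real.pi_pos
  have h1 : ∫ x in (0 : ℝ)..φ₀, Real.sin (x + ψ) ≤ ∫ x in (0 : ℝ)..φ₀, √(Real.sin (x + ψ)) := by
    refine intervalIntegral.integral_mono_on (by linarith)
      ((by fun_prop : Continuous fun x => Real.sin (x + ψ)).intervalIntegrable _ _)
      ((by fun_prop : Continuous fun x => √(Real.sin (x + ψ))).intervalIntegrable _ _)
      fun x hx => ?_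
    have hn : 0 ≤ Real.sin (x + ψ) :=
      Real.sin_nonneg_of_nonneg_of_le_pi (by linarith [hx.1, hψ.1]) (by linarith [hx.2, hψ.2])
    have hl := Real.sin_le_one (x + ψ)
    exact Real.le_sqrt_of_sq_le (by nlinarith)
  refine le_trans ?_ h1
  rw [intervalIntegral.integral_comp_add_right, integral_sin]
  have h2 : Real.cos (φ₀ + ψ) = - Real.cos (Real.pi - φ₀ - ψ) := by
    rw [← Real.cos_pi_sub]
    congr 1
    ring
  rw [h2, zero_add]
  have h3 : Real.sin ψ ≤ Real.cos (Real.pi - φ₀ - ψ) := by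
    rw [← Real.cos_pi_div_two_sub]
    exact Real.cos_le_cos_of_nonneg_of_le_pi (by linarith [hψ.2]) (by linarith [hψ.1])
      (by linarith)
  have h4 : 0 ≤ Real.cos ψ := Real.cos_nonneg_of_neg_pi_div_two_le_of_le (by linarith [hψ.1])
    (by linarith [hψ.2])
  have h5 : 0 ≤ Real.sin ψ := Real.sin_nonneg_of_nonneg_of_le_pi hψ.1 (by linarith [hψ.2])
  nlinarith [Real.sin_sq_add_cos_sq ψ]

/-- A pair of left-turning paths of short length with prescribed turnings and total displacement,
whose energy is the minimum given by the Cauchy-Schwarz lower bound. -/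
theorem exists_short_arcs {φ₀ φ₁ : ℝ} (hφ₁ : φ₁ ∈ Icc 0 φ₀) (h0 : Real.pi / 2 ≤ φ₀)
    (hπ : φ₀ ≤ Real.pi) {W : ℂ}
    (hW : ∀ ψ ∈ Icc 0 (Real.pi - φ₀), 0 < (Complex.exp (ψ * Complex.I) * W).im) :
    ∃ ψ ∈ Icc 0 (Real.pi - φ₀), ∃ (L₀ L₁ : ℝ) (W₀ W₁ : ℂ) (e₀ e₁ : ℝ),
      IsArc L₀ φ₀ W₀ e₀ ∧ IsArc L₁ φ₁ W₁ e₁ ∧ W₀ + W₁ = W ∧ L₀ + L₁ ≤ 65 * ‖W‖ ∧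
      (e₀ + e₁) * (Complex.exp (ψ * Complex.I) * W).im =
        ((∫ x in (0 : ℝ)..φ₀, √(Real.sin (x + ψ))) + ∫ x in (0 : ℝ)..φ₁, √(Real.sin (x + ψ))) ^ 2 := by
  have hφ₀ : φ₀ ∈ Icc 0 φ₀ := right_mem_Icc.mpr (hφ₁.1.trans hφ₁.2)
  set A : ℝ → ℝ := fun ψ =>
    (∫ x in (0 : ℝ)..φ₀, √(Real.sin (x + ψ))) + ∫ x in (0 : ℝ)..φ₁, √(Real.sin (x + ψ)) with hA
  set y : ℝ → ℝ := fun ψ => (Complex.exp (ψ * Complex.I) * W).im with hy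
  set M : ℝ → ℂ := fun ψ => elasticaDisplacement φ₀ ψ + elasticaDisplacement φ₁ ψ with hM
  -- The dilation that gives the two elastica arcs together the height of `W` in the frame rotated
  -- by `ψ`. The remaining mismatch is horizontal in that frame and is measured by `r`.
  set c : ℝ → ℝ := fun ψ => y ψ / A ψ with hc
  set r : ℝ → ℝ := fun ψ => (Complex.exp (ψ * Complex.I) * (W - c ψ * M ψ)).re with hr
  have hA1 : ∀ ψ ∈ Icc 0 (Real.pi - φ₀), 1 ≤ A ψ := fun ψ hψ =>
    (one_le_integral_sqrt_sin h0 hψ).trans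
      (le_add_of_nonneg_right (integral_sqrt_sin_nonneg hφ₁.1 ψ))
  have hAc : Continuous A := (continuous_integral_sqrt_sin φ₀).add (continuous_integral_sqrt_sin φ₁)
  have hyc : Continuous y := by fun_prop
  have hMc : ContinuousOn M (Icc 0 (Real.pi - φ₀)) :=
    (continuousOn_elasticaDisplacement hφ₀).add (continuousOn_elasticaDisplacement hφ₁)
  have hcc : ContinuousOn c (Icc 0 (Real.pi - φ₀)) :=
    hyc.continuousOn.div hAc.continuousOn fun ψ hψ => by linarith [hA1 ψ hψ]
  have hrc : ContinuousOn r (Icc 0 (Real.pi - φ₀)) := by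
    refine Complex.continuous_re.comp_continuousOn ?_
    refine ContinuousOn.mul (by fun_prop) (continuousOn_const.sub ?_)
    exact (Complex.continuous_ofReal.comp_continuousOn hcc).mul hMc
  have hcpos : ∀ ψ ∈ Icc 0 (Real.pi - φ₀), 0 < c ψ := fun ψ hψ =>
    div_pos (hW ψ hψ) (by linarith [hA1 ψ hψ])
  have hexp : ∀ ψ : ℝ, ‖Complex.exp (ψ * Complex.I)‖ = 1 := Complex.norm_exp_ofReal_mul_I
  have hcW : ∀ ψ ∈ Icc 0 (Real.pi - φ₀), c ψ ≤ ‖W‖ := by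
    intro ψ hψ
    have h1 : y ψ ≤ ‖W‖ := by
      refine (Complex.im_le_norm _).trans ?_
      rw [norm_mul, hexp, one_mul]
    exact (div_le_self (hW ψ hψ).le (hA1 ψ hψ)).trans h1
  have hrem : ∀ ψ ∈ Icc 0 (Real.pi - φ₀),
      W - c ψ * M ψ = r ψ * Complex.exp (-(ψ * Complex.I)) := by
    intro ψ hψ
    have him : (Complex.exp (ψ * Complex.I) * (W - c ψ * M ψ)).im = 0 := by
      have h1 := im_exp_mul_elasticaDisplacement hφ₀ hψ
      have h2 := im_exp_mul_elasticaDisplacement hφ₁ hψ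
      have h3 : Complex.exp (ψ * Complex.I) * (W - c ψ * M ψ) = Complex.exp (ψ * Complex.I) * W -
          c ψ * (Complex.exp (ψ * Complex.I) * elasticaDisplacement φ₀ ψ +
            Complex.exp (ψ * Complex.I) * elasticaDisplacement φ₁ ψ) := by
        rw [hM]
        ring
      rw [h3, Complex.sub_im, Complex.im_ofReal_mul, Complex.add_im, h1, h2]
      have : A ψ ≠ 0 := by linarith [hA1 ψ hψ]
      change y ψ - y ψ / A ψ * A ψ = 0
      field_simp
      ring
    have h5 : Complex.exp (ψ * Complex.I) * (W - c ψ * M ψ) = r ψ := by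
      apply Complex.ext
      · rw [Complex.ofReal_re]
      · rw [him, Complex.ofReal_im]
    rw [← h5, mul_right_comm, ← Complex.exp_add]
    simp
  have hE : ∀ ψ ∈ Icc 0 (Real.pi - φ₀), ((∫ x in (0 : ℝ)..φ₀, √(Real.sin (x + ψ))) / c ψ +
      (∫ x in (0 : ℝ)..φ₁, √(Real.sin (x + ψ))) / c ψ) * y ψ = A ψ ^ 2 := by
    intro ψ hψ
    have h1 : A ψ ≠ 0 := by linarith [hA1 ψ hψ]
    have h2 : y ψ ≠ 0 := (hW ψ hψ).ne'
    rw [← add_div]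
    change A ψ / (y ψ / A ψ) * y ψ = A ψ ^ 2
    field_simp
  -- Each arc has length at most `16 * ‖W‖`, and `|r ψ|` is at most `‖W‖` plus both arc lengths: `65
  -- = 32 + (1 + 32)`.
  have hlen : ∀ ψ ∈ Icc 0 (Real.pi - φ₀), c ψ * (∫ x in (0 : ℝ)..φ₀, (√(Real.sin (x + ψ)))⁻¹) +
      c ψ * (∫ x in (0 : ℝ)..φ₁, (√(Real.sin (x + ψ)))⁻¹) + |r ψ| ≤ 65 * ‖W‖ := by
    intro ψ hψ
    have h1 := isArc_elastica hφ₀ hψ (hcpos ψ hψ)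
    have h2 := isArc_elastica hφ₁ hψ (hcpos ψ hψ)
    have h3 : |r ψ| ≤ ‖W‖ + (‖(c ψ * elasticaDisplacement φ₀ ψ : ℂ)‖ +
        ‖(c ψ * elasticaDisplacement φ₁ ψ : ℂ)‖) := by
      refine (Complex.abs_re_le_norm _).trans ?_
      rw [norm_mul, hexp, one_mul]
      refine (norm_sub_le _ _).trans ?_
      gcongr
      rw [hM, mul_add]
      exact norm_add_le _ _
    have h4 := h1.norm_le
    have h5 := h2.norm_le
    have h6 := mul_le_mul (hcW ψ hψ) (integral_inv_sqrt_sin_le hφ₀ hπ hψ)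
      (intervalIntegral.integral_nonneg hφ₀.1 fun _ _ => by positivity) (norm_nonneg W)
    have h7 := mul_le_mul (hcW ψ hψ) (integral_inv_sqrt_sin_le hφ₁ hπ hψ)
      (intervalIntegral.integral_nonneg hφ₁.1 fun _ _ => by positivity) (norm_nonneg W)
    linarith
  have hJ : (0 : ℝ) ≤ Real.pi - φ₀ := by linarith
  have m0 : (0 : ℝ) ∈ Icc 0 (Real.pi - φ₀) := left_mem_Icc.mpr hJ
  have m1 : Real.pi - φ₀ ∈ Icc 0 (Real.pi - φ₀) := right_mem_Icc.mpr hJ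
  -- A nonnegative defect at `ψ = 0` points in the initial direction and is filled by a segment put
  -- in front of the first arc.
  rcases le_total 0 (r 0) with hr0 | hr0
  · have h := (isArc_line hr0).concat (isArc_elastica hφ₀ m0 (hcpos 0 m0))
    simp only [zero_add, Complex.ofReal_zero, zero_mul, Complex.exp_zero, one_mul] at h
    refine ⟨0, m0, _, _, _, _, _, _, h, isArc_elastica hφ₁ m0 (hcpos 0 m0), ?_, ?_, hE 0 m0⟩
    · have := hrem 0 m0
      rw [Complex.ofReal_zero, zero_mul, neg_zero, Complex.exp_zero, mul_one, sub_eq_iff_eq_add,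
        hM] at this
      rw [this]
      ring
    · have := hlen 0 m0
      rw [abs_of_nonneg hr0] at this
      linarith
  -- A nonpositive defect at `ψ = π - φ₀` points in the final direction `φ₀` and is filled by a
  -- segment appended to the first arc. In both cases the segment costs neither energy nor height.
  rcases le_total (r (Real.pi - φ₀)) 0 with hr1 | hr1
  · have h := (isArc_elastica hφ₀ m1 (hcpos _ m1)).concat (isArc_line (neg_nonneg.mpr hr1))
    simp only [add_zero] at h
    refine ⟨Real.pi - φ₀, m1, _, _, _, _, _, _, h, isArc_elastica hφ₁ m1 (hcpos _ m1), ?_, ?_,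
      hE _ m1⟩
    · have := hrem _ m1
      have h2 : Complex.exp (-((Real.pi - φ₀ : ℝ) * Complex.I)) =
          -Complex.exp (φ₀ * Complex.I) := by
        rw [← Complex.exp_sub_pi_mul_I]
        congr 1
        push_cast
        ring
      rw [h2, sub_eq_iff_eq_add, hM] at this
      rw [this]
      push_cast
      ring
    · have := hlen _ m1
      rw [abs_of_nonpos hr1] at this
      linarith
  -- Otherwise `r` changes sign, and at a zero the two arcs need no segment.
  obtain ⟨ψ, hψ, hψ0⟩ : ∃ ψ ∈ Icc 0 (Real.pi - φ₀), r ψ = 0 :=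
    intermediate_value_Icc hJ hrc ⟨hr0, hr1⟩
  refine ⟨ψ, hψ, _, _, _, _, _, _, isArc_elastica hφ₀ hψ (hcpos ψ hψ),
    isArc_elastica hφ₁ hψ (hcpos ψ hψ), ?_, ?_, hE ψ hψ⟩
  · have := hrem ψ hψ
    rw [hψ0, Complex.ofReal_zero, zero_mul, sub_eq_zero] at this
    rw [this, ← mul_add]
  · have := hlen ψ hψ
    rw [hψ0, abs_zero, add_zero] at this
    exact this

/-! ### Short replacements of no larger energy -/

/-- If the tangent angle stays in `[0, π / 2]`, rotation by `π / 4` leaves a vertical component of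
at least `1 / 2` everywhere. -/
theorem IsArc.length_le {L φ e : ℝ} {W : ℂ} (h : IsArc L φ W e) (hφ : φ ≤ Real.pi / 2) :
    L / 2 ≤ (Complex.exp ((Real.pi / 4 : ℝ) * Complex.I) * W).im := by
  obtain ⟨hL, K, hK, h0, rfl, rfl, -⟩ := h
  have hc := continuous_tangentAngle hK
  rw [im_exp_mul_displacement hK]
  have h1 : ∫ _ in (0 : ℝ)..L, (1 / 2 : ℝ) ≤
      ∫ s in (0 : ℝ)..L, Real.sin (tangentAngle K s + Real.pi / 4) := by
    refine intervalIntegral.integral_mono_on hL intervalIntegrable_const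
      ((by fun_prop : Continuous _).intervalIntegrable _ _) fun s hs => ?_
    have l := monotone_tangentAngle hK h0 hs.1
    have u := monotone_tangentAngle hK h0 hs.2
    rw [tangentAngle_zero] at l
    have c0 := Real.cos_nonneg_of_neg_pi_div_two_le_of_le (x := tangentAngle K s)
      (by linarith [Real.pi_pos]) (by linarith)
    have s0 := Real.sin_nonneg_of_nonneg_of_le_pi l (by linarith [Real.pi_pos])
    have h2 : 1 ≤ Real.sin (tangentAngle K s) + Real.cos (tangentAngle K s) := by
      nlinarith [Real.sin_sq_add_cos_sq (tangentAngle K s)]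
    have h3 : 1 ≤ √2 := Real.one_le_sqrt.mpr (by norm_num)
    rw [Real.sin_add, Real.cos_pi_div_four, Real.sin_pi_div_four]
    nlinarith
  rw [intervalIntegral.integral_const, smul_eq_mul] at h1
  linarith

/-- A pair of left-turning paths may be replaced by a short pair of no larger energy. -/
theorem IsArc.exists_short {L₁ L₂ φ₁ φ₂ e₁ e₂ : ℝ} {W₁ W₂ : ℂ} (h₁ : IsArc L₁ φ₁ W₁ e₁)
    (h₂ : IsArc L₂ φ₂ W₂ e₂) (hφ₁ : φ₁ ≤ Real.pi) (hφ₂ : φ₂ ≤ Real.pi) :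
    ∃ (L₁' L₂' : ℝ) (W₁' W₂' : ℂ) (e₁' e₂' : ℝ), IsArc L₁' φ₁ W₁' e₁' ∧ IsArc L₂' φ₂ W₂' e₂' ∧
      W₁' + W₂' = W₁ + W₂ ∧ L₁' + L₂' ≤ 65 * ‖W₁ + W₂‖ ∧ e₁' + e₂' ≤ e₁ + e₂ := by
  wlog hle : φ₂ ≤ φ₁ generalizing L₁ L₂ φ₁ φ₂ e₁ e₂ W₁ W₂
  · obtain ⟨a, b, c, d, e, f, g1, g2, g3, g4, g5⟩ := this h₂ h₁ hφ₂ hφ₁ (le_of_not_ge hle)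
    exact ⟨b, a, d, c, f, e, g2, g1, by rw [add_comm, g3, add_comm],
      by rw [add_comm b, add_comm W₁]; exact g4, by linarith⟩
  rcases le_total φ₁ (Real.pi / 2) with hsm | hbig
  · refine ⟨L₁, L₂, W₁, W₂, e₁, e₂, h₁, h₂, rfl, ?_, le_rfl⟩
    have l₁ := h₁.length_le hsm
    have l₂ := h₂.length_le (hle.trans hsm)
    have h3 := Complex.im_le_norm (Complex.exp ((Real.pi / 4 : ℝ) * Complex.I) * (W₁ + W₂))
    rw [norm_mul, Complex.norm_exp_ofReal_mul_I, one_mul, mul_add, Complex.add_im] at h3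
    have := norm_nonneg (W₁ + W₂)
    linarith
  have hφ : φ₂ ∈ Icc 0 φ₁ := ⟨h₂.turning_nonneg, hle⟩
  have he : 0 ≤ e₁ + e₂ := add_nonneg h₁.energy_nonneg h₂.energy_nonneg
  have hcs : ∀ ψ ∈ Icc 0 (Real.pi - φ₁), _ := fun ψ hψ =>
    h₁.sq_add_integral_sqrt_sin_le h₂ hψ.1 (by linarith [hψ.2]) (by linarith [hψ.2])
  have hpos : ∀ ψ ∈ Icc 0 (Real.pi - φ₁), 0 < (Complex.exp (ψ * Complex.I) * (W₁ + W₂)).im := by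
    intro ψ hψ
    have h3 := hcs ψ hψ
    have h4 := one_le_integral_sqrt_sin hbig hψ
    have h5 := integral_sqrt_sin_nonneg hφ.1 ψ
    -- The lower bound is strictly positive, which forces the height to be positive.
    refine pos_of_mul_pos_right (lt_of_lt_of_le ?_ h3) he
    positivity
  obtain ⟨ψ, hψ, L₁', L₂', W₁', W₂', e₁', e₂', a₁, a₂, hW, hL, hE⟩ :=
    exists_short_arcs hφ hbig hφ₁ hpos
  refine ⟨L₁', L₂', W₁', W₂', e₁', e₂', a₁, a₂, hW, hL, ?_⟩
  -- For this `ψ` the new pair attains equality while the old one satisfies the inequality with the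
  -- same height.
  have := hcs ψ hψ
  rw [← hE] at this
  exact le_of_mul_le_mul_right this (hpos ψ hψ)

/-! ### Weak limits of paths -/

/-- Cauchy-Schwarz against the constant `1`, again through a discriminant. Bounded energy thus makes
tangent angles uniformly Hölder, which allows the length to vary along a sequence. -/
theorem sq_tangentAngle_sub_le {K : ℝ → ℝ} (hK : MemLp K 2 volume) {x y : ℝ} (hxy : x ≤ y) :
    (tangentAngle K y - tangentAngle K x) ^ 2 ≤ (y - x) * ∫ s, K s ^ 2 := by
  have hK2 : IntervalIntegrable (fun s => K s ^ 2) volume x y := hK.integrable_sq.intervalIntegrable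
  have hKe : ∫ s in x..y, K s ^ 2 ≤ ∫ s, K s ^ 2 := by
    rw [intervalIntegral.integral_of_le hxy]
    exact setIntegral_le_integral hK.integrable_sq (ae_of_all _ fun s => sq_nonneg _)
  have hq : ∀ t : ℝ, 0 ≤ (y - x) * (t * t) + (-2 * ∫ s in x..y, K s) * t + ∫ s, K s ^ 2 := by
    intro t
    have h1 : 0 ≤ ∫ s in x..y, (t - K s) ^ 2 :=
      intervalIntegral.integral_nonneg hxy fun s _ => sq_nonneg _
    have h2 : ∀ s, (t - K s) ^ 2 = t ^ 2 - 2 * t * K s + K s ^ 2 := fun s => by ring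
    have i2 : IntervalIntegrable (fun s => 2 * t * K s) volume x y :=
      (hK.intervalIntegrable_real x y).const_mul _
    simp only [h2] at h1
    rw [intervalIntegral.integral_add (intervalIntegrable_const.sub i2) hK2,
      intervalIntegral.integral_sub intervalIntegrable_const i2,
      intervalIntegral.integral_const_mul, intervalIntegral.integral_const, smul_eq_mul] at h1
    nlinarith
  have hd := discrim_le_zero hq
  rw [discrim] at hd
  rw [tangentAngle_sub hK]
  nlinarith

theorem sq_tangentAngle_sub_le_abs {K : ℝ → ℝ} (hK : MemLp K 2 volume) (x y : ℝ) :
    (tangentAngle K y - tangentAngle K x) ^ 2 ≤ |y - x| * ∫ s, K s ^ 2 := by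
  rcases le_total x y with h | h
  · rw [abs_of_nonneg (sub_nonneg.mpr h)]
    exact sq_tangentAngle_sub_le hK h
  · rw [abs_of_nonpos (sub_nonpos.mpr h), neg_sub, ← neg_sq, neg_sub]
    exact sq_tangentAngle_sub_le hK h

theorem norm_displacement_sub_le {K : ℝ → ℝ} (hK : MemLp K 2 volume) (x y : ℝ) :
    ‖displacement K y - displacement K x‖ ≤ |y - x| := by
  have hc := continuous_tangent hK
  rw [displacement, displacement, intervalIntegral.integral_interval_sub_left
    (hc.intervalIntegrable _ _) (hc.intervalIntegrable _ _)]
  refine (intervalIntegral.norm_integral_le_of_norm_le_const (C := 1) fun s _ => ?_).trans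
    (one_mul _).le
  rw [Complex.norm_exp_ofReal_mul_I]

/-- Sequential weak compactness of bounded sets of square integrable functions. -/
theorem exists_subseq_tendsto_setIntegral {K : ℕ → ℝ → ℝ} (hK : ∀ n, MemLp (K n) 2 volume)
    {e : ℕ → ℝ} {e₀ : ℝ} (he : ∀ n, ∫ s, K n s ^ 2 ≤ e n) (hlim : Tendsto e atTop (𝓝 e₀)) :
    ∃ K₀ : ℝ → ℝ, MemLp K₀ 2 volume ∧ ∫ s, K₀ s ^ 2 ≤ e₀ ∧ ∃ σ : ℕ → ℕ, StrictMono σ ∧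
      ∀ s : Set ℝ, MeasurableSet s → volume s ≠ ⊤ →
        Tendsto (fun n => ∫ x in s, K (σ n) x) atTop (𝓝 (∫ x in s, K₀ x)) := by
  have : Fact ((2 : ENNReal) ≠ ⊤) := ⟨by norm_num⟩
  set u : ℕ → Lp ℝ 2 (volume : Measure ℝ) := fun n => (hK n).toLp (K n) with hu
  have hnorm : ∀ (v : Lp ℝ 2 (volume : Measure ℝ)), ‖v‖ ^ 2 = ∫ s, v s ^ 2 := by
    intro v
    rw [← real_inner_self_eq_norm_sq, L2.inner_def]
    simp [sq]
  have hun : ∀ n, ‖u n‖ ^ 2 ≤ e n := by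
    intro n
    rw [hnorm]
    refine le_of_eq_of_le (integral_congr_ae ?_) (he n)
    filter_upwards [(hK n).coeFn_toLp] with s hs
    simp only [hu, hs]
  obtain ⟨E, hE⟩ := hlim.bddAbove_range
  have hball : ∀ n, StrongDual.toWeakDual (InnerProductSpace.toDual ℝ _ (u n)) ∈
      WeakDual.toStrongDual ⁻¹' Metric.closedBall 0 (√E) := by
    intro n
    simp only [mem_preimage, Metric.mem_closedBall, dist_zero_right]
    have : ‖(InnerProductSpace.toDual ℝ _ (u n) : StrongDual ℝ (Lp ℝ 2 (volume : Measure ℝ)))‖ ≤ √E := by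
      rw [LinearIsometryEquiv.norm_map]
      exact Real.le_sqrt_of_sq_le ((hun n).trans (hE (mem_range_self n)))
    exact this
  -- The Riesz isometry turns the curvatures into functionals, to which the sequential
  -- Banach-Alaoglu theorem applies.
  obtain ⟨ℓ, -, σ, hσ, hℓ⟩ := WeakDual.isSeqCompact_closedBall ℝ (Lp ℝ 2 (volume : Measure ℝ)) 0 (√E) hball
  set u₀ := (InnerProductSpace.toDual ℝ (Lp ℝ 2 (volume : Measure ℝ))).symm
    (WeakDual.toStrongDual ℓ) with hu₀
  have hinner : ∀ v, Tendsto (fun n => inner ℝ (u (σ n)) v) atTop (𝓝 (inner ℝ u₀ v)) := by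
    intro v
    have h1 := ((WeakDual.eval_continuous v).tendsto ℓ).comp hℓ
    have h2 : inner ℝ u₀ v = ℓ v := by
      rw [hu₀, InnerProductSpace.toDual_symm_apply]
      rfl
    rw [h2]
    exact h1
  refine ⟨u₀, Lp.memLp u₀, ?_, σ, hσ, ?_⟩
  -- Lower semicontinuity of the norm, by testing the weak convergence on the limit itself.
  · rw [← hnorm]
    have h1 := hinner u₀
    rw [real_inner_self_eq_norm_sq] at h1
    have h2 : Tendsto (fun n => √(e (σ n)) * ‖u₀‖) atTop (𝓝 (√e₀ * ‖u₀‖)) :=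
      ((Real.continuous_sqrt.tendsto _).comp (hlim.comp hσ.tendsto_atTop)).mul_const _
    have h3 : ‖u₀‖ ^ 2 ≤ √e₀ * ‖u₀‖ := by
      refine le_of_tendsto_of_tendsto' h1 h2 fun n => ?_
      refine (real_inner_le_norm _ _).trans ?_
      gcongr
      exact Real.le_sqrt_of_sq_le (hun _)
    have he0 : 0 ≤ e₀ := ge_of_tendsto' hlim fun n =>
      (integral_nonneg fun s => sq_nonneg _).trans (he n)
    rcases (norm_nonneg u₀).eq_or_lt with h4 | h4
    · rw [← h4]
      simpa using he0
    · have h5 : ‖u₀‖ ≤ √e₀ := by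
        rw [sq] at h3
        exact le_of_mul_le_mul_right h3 h4
      calc ‖u₀‖ ^ 2 ≤ √e₀ ^ 2 := by gcongr
        _ = e₀ := Real.sq_sqrt he0
  · intro s hs hμ
    have h1 := hinner (indicatorConstLp 2 hs hμ 1)
    have h2 : ∀ v : Lp ℝ 2 (volume : Measure ℝ), inner ℝ v (indicatorConstLp 2 hs hμ (1 : ℝ)) =
        ∫ x in s, v x := by
      intro v
      rw [real_inner_comm, L2.inner_indicatorConstLp_one]
    simp only [h2] at h1
    refine h1.congr fun n => setIntegral_congr_ae hs ?_
    filter_upwards [(hK (σ n)).coeFn_toLp] with x hx _ using hx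

/-- Left-turning paths of bounded length and energy are closed under limits. -/
theorem IsArc.of_tendsto {L φ e : ℕ → ℝ} {W : ℕ → ℂ} {L₀ φ₀ e₀ : ℝ} {W₀ : ℂ}
    (h : ∀ n, IsArc (L n) (φ n) (W n) (e n)) (hL : Tendsto L atTop (𝓝 L₀))
    (hφ : Tendsto φ atTop (𝓝 φ₀)) (hW : Tendsto W atTop (𝓝 W₀)) (he : Tendsto e atTop (𝓝 e₀)) :
    IsArc L₀ φ₀ W₀ e₀ := by
  choose hL0 K hK hn hφ' hW' he' using h
  obtain ⟨K₀, hK₀, hE, σ, hσ, hset⟩ := exists_subseq_tendsto_setIntegral hK he' he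
  have hL₀ : 0 ≤ L₀ := ge_of_tendsto' hL hL0
  have hσt := hσ.tendsto_atTop
  have hang : ∀ s, 0 ≤ s → Tendsto (fun n => tangentAngle (K (σ n)) s) atTop
      (𝓝 (tangentAngle K₀ s)) := by
    intro s hs
    simp only [tangentAngle, intervalIntegral.integral_of_le hs]
    exact hset _ measurableSet_Ioc (by simp)
  have hLσ : Tendsto (fun n => |L (σ n) - L₀|) atTop (𝓝 0) := by
    have := ((hL.comp hσt).sub_const L₀).abs
    simpa using this
  refine ⟨hL₀, K₀, hK₀, ?_, ?_, ?_, hE⟩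
  · refine ae_nonneg_of_forall_setIntegral_nonneg_of_sigmaFinite ?_ ?_
    · intro s hs hμ
      have : IsFiniteMeasure (volume.restrict s) := ⟨by simpa using hμ⟩
      exact (hK₀.restrict s).integrable (by norm_num)
    · intro s hs hμ
      exact ge_of_tendsto' (hset s hs hμ.ne) fun n =>
        integral_nonneg_of_ae (ae_restrict_of_ae (hn _))
  -- Weak convergence controls the angle at the fixed arclength `L₀`; the Hölder bound absorbs the
  -- passage from `L (σ n)` to `L₀`.
  · refine tendsto_nhds_unique ?_ (hφ.comp hσt)
    have h1 : Tendsto (fun n => √(|L (σ n) - L₀| * e (σ n))) atTop (𝓝 0) := by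
      have := (Real.continuous_sqrt.tendsto _).comp (hLσ.mul (he.comp hσt))
      simpa only [zero_mul, Real.sqrt_zero, Function.comp_def] using this
    have h2 : Tendsto (fun n => tangentAngle (K (σ n)) (L (σ n)) - tangentAngle (K (σ n)) L₀)
        atTop (𝓝 0) := by
      refine squeeze_zero_norm (fun n => ?_) h1
      rw [Real.norm_eq_abs]
      refine Real.abs_le_sqrt ((sq_tangentAngle_sub_le_abs (hK _) _ _).trans ?_)
      gcongr
      exact he' _
    have h3 := h2.add (hang L₀ hL₀)
    simp only [sub_add_cancel, zero_add] at h3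
    refine h3.congr fun n => hφ' _
  · refine tendsto_nhds_unique ?_ (hW.comp hσt)
    have h2 : Tendsto (fun n => displacement (K (σ n)) (L (σ n)) - displacement (K (σ n)) L₀)
        atTop (𝓝 0) :=
      squeeze_zero_norm (fun n => norm_displacement_sub_le (hK _) _ _) hLσ
    -- The tangents converge pointwise and have norm `1`, so dominated convergence applies.
    have h4 : Tendsto (fun n => displacement (K (σ n)) L₀) atTop (𝓝 (displacement K₀ L₀)) := by
      refine intervalIntegral.tendsto_integral_filter_of_dominated_convergence (fun _ => 1)
        (Eventually.of_forall fun n => (continuous_tangent (hK _)).aestronglyMeasurable)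
        (Eventually.of_forall fun n => ae_of_all _ fun s _ => by
          rw [Complex.norm_exp_ofReal_mul_I]) intervalIntegrable_const (ae_of_all _ fun s hs => ?_)
      rw [uIoc_of_le hL₀] at hs
      have hc : Continuous fun x : ℝ => Complex.exp (x * Complex.I) := by fun_prop
      exact (hc.tendsto _).comp (hang s hs.1.le)
    have h3 := h2.add h4
    simp only [sub_add_cancel, zero_add] at h3
    exact h3.congr fun n => hW' _

/-! ### S-shaped pieces: closedness and existence -/

/-- There is a path with displacement `Z` whose tangent angle increases from `α` to some `M` and
then decreases to `β`, each by at most `π`, the square integral of whose curvature is at most `e`.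
The two parts are recorded as left-turning paths starting at the point with tangent angle `M`. -/
def IsUpDown (Z : ℂ) (α β e : ℝ) : Prop :=
  ∃ (M L₁ L₂ : ℝ) (W₁ W₂ : ℂ) (e₁ e₂ : ℝ), IsArc L₁ (M - α) W₁ e₁ ∧ IsArc L₂ (M - β) W₂ e₂ ∧
    M - α ≤ Real.pi ∧ M - β ≤ Real.pi ∧
    Complex.exp (M * Complex.I) * (starRingEnd ℂ) (W₁ + W₂) = Z ∧ e₁ + e₂ ≤ e

/-- There is an s-shaped path with displacement `Z`, initial tangent angle `α` and final tangent
angle `β`, the square integral of whose curvature is at most `e`. -/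
def IsPiece (Z : ℂ) (α β e : ℝ) : Prop :=
  IsUpDown Z α β e ∨ IsUpDown ((starRingEnd ℂ) Z) (-α) (-β) e

/-- Replacing each pair of arcs by a short one bounds all seven parameters: `0 ≤ M - α ≤ π`, lengths
by `65 * ‖Z‖`, displacements by lengths, energies by `e`. A convergent subsequence exists, and arcs
are closed under limits. -/
theorem IsUpDown.of_tendsto {Z : ℂ} {α β e : ℕ → ℝ} {α₀ β₀ e₀ : ℝ}
    (h : ∀ n, IsUpDown Z (α n) (β n) (e n)) (hα : Tendsto α atTop (𝓝 α₀))
    (hβ : Tendsto β atTop (𝓝 β₀)) (he : Tendsto e atTop (𝓝 e₀)) : IsUpDown Z α₀ β₀ e₀ := by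
  have hshort : ∀ n, ∃ x : ℝ × ℝ × ℝ × ℂ × ℂ × ℝ × ℝ,
      IsArc x.2.1 (x.1 - α n) x.2.2.2.1 x.2.2.2.2.2.1 ∧
      IsArc x.2.2.1 (x.1 - β n) x.2.2.2.2.1 x.2.2.2.2.2.2 ∧
      x.1 - α n ≤ Real.pi ∧ x.1 - β n ≤ Real.pi ∧
      Complex.exp (x.1 * Complex.I) * (starRingEnd ℂ) (x.2.2.2.1 + x.2.2.2.2.1) = Z ∧
      x.2.2.2.2.2.1 + x.2.2.2.2.2.2 ≤ e n ∧ x.2.1 + x.2.2.1 ≤ 65 * ‖Z‖ := by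
    intro n
    obtain ⟨M, L₁, L₂, W₁, W₂, e₁, e₂, h₁, h₂, hp₁, hp₂, hZ, hE⟩ := h n
    obtain ⟨L₁', L₂', W₁', W₂', e₁', e₂', a₁, a₂, hW, hL, hE'⟩ := h₁.exists_short h₂ hp₁ hp₂
    have hn : ‖Z‖ = ‖W₁ + W₂‖ := by
      rw [← hZ, norm_mul, Complex.norm_exp_ofReal_mul_I, one_mul, RCLike.norm_conj]
    exact ⟨(M, L₁', L₂', W₁', W₂', e₁', e₂'), a₁, a₂, hp₁, hp₂, by rw [hW]; exact hZ,
      hE'.trans hE, by rw [hn]; exact hL⟩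
  choose x h₁ h₂ hp₁ hp₂ hZ hE hL using hshort
  obtain ⟨Ca, hCa⟩ := (Metric.isBounded_range_of_tendsto α hα).exists_norm_le
  obtain ⟨Ce, hCe⟩ := (Metric.isBounded_range_of_tendsto e he).exists_norm_le
  have hbdd : ∀ n, x n ∈ Metric.closedBall 0 (max (Ca + Real.pi) (max (65 * ‖Z‖) Ce)) := by
    intro n
    have b1 := hCa _ (mem_range_self n)
    have b2 := hCe _ (mem_range_self n)
    rw [Real.norm_eq_abs] at b1 b2
    have b3 := abs_le.mp b1
    have b4 := le_of_abs_le b2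
    have c1 := (h₁ n).turning_nonneg
    have d1 := (h₁ n).energy_nonneg
    have d2 := (h₂ n).energy_nonneg
    have l1 := (h₁ n).1
    have l2 := (h₂ n).1
    have w1 := (h₁ n).norm_le
    have w2 := (h₂ n).norm_le
    have p := hp₁ n
    have q := hL n
    have r := hE n
    have hpi := Real.pi_pos
    rw [mem_closedBall_zero_iff]
    simp only [Prod.norm_def, sup_le_iff, Real.norm_eq_abs]
    have m1 : Ca + Real.pi ≤ max (Ca + Real.pi) (max (65 * ‖Z‖) Ce) := le_max_left _ _
    have m2 : 65 * ‖Z‖ ≤ max (Ca + Real.pi) (max (65 * ‖Z‖) Ce) :=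
      (le_max_left _ _).trans (le_max_right _ _)
    have m3 : Ce ≤ max (Ca + Real.pi) (max (65 * ‖Z‖) Ce) :=
      (le_max_right _ _).trans (le_max_right _ _)
    refine ⟨?_, ?_, ?_, ?_, ?_, ?_, ?_⟩
    · exact abs_le.mpr ⟨by linarith [b3.1], by linarith [b3.2]⟩
    · rw [abs_of_nonneg l1]; linarith
    · rw [abs_of_nonneg l2]; linarith
    · linarith
    · linarith
    · rw [abs_of_nonneg d1]; linarith
    · rw [abs_of_nonneg d2]; linarith
  obtain ⟨⟨M, L₁, L₂, W₁, W₂, e₁, e₂⟩, -, σ, hσ, hx⟩ :=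
    tendsto_subseq_of_bounded Metric.isBounded_closedBall hbdd
  have hσt := hσ.tendsto_atTop
  have tα := hα.comp hσt
  have tβ := hβ.comp hσt
  have te := he.comp hσt
  have t1 := (continuous_fst.tendsto _).comp hx
  have s1 := (continuous_snd.tendsto _).comp hx
  have t2 := (continuous_fst.tendsto _).comp s1
  have s2 := (continuous_snd.tendsto _).comp s1
  have t3 := (continuous_fst.tendsto _).comp s2
  have s3 := (continuous_snd.tendsto _).comp s2
  have t4 := (continuous_fst.tendsto _).comp s3
  have s4 := (continuous_snd.tendsto _).comp s3
  have t5 := (continuous_fst.tendsto _).comp s4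
  have s5 := (continuous_snd.tendsto _).comp s4
  have t6 := (continuous_fst.tendsto _).comp s5
  have t7 := (continuous_snd.tendsto _).comp s5
  refine ⟨M, L₁, L₂, W₁, W₂, e₁, e₂, IsArc.of_tendsto (fun n => h₁ (σ n)) t2 (t1.sub tα) t4 t6,
    IsArc.of_tendsto (fun n => h₂ (σ n)) t3 (t1.sub tβ) t5 t7,
    le_of_tendsto' (t1.sub tα) fun n => hp₁ _, le_of_tendsto' (t1.sub tβ) fun n => hp₂ _, ?_,
    le_of_tendsto_of_tendsto' (t6.add t7) te fun n => hE _⟩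
  have hc : Continuous fun z : ℝ × ℂ × ℂ =>
      Complex.exp (z.1 * Complex.I) * (starRingEnd ℂ) (z.2.1 + z.2.2) := by fun_prop
  have := (hc.tendsto (M, W₁, W₂)).comp (t1.prodMk_nhds (t4.prodMk_nhds t5))
  exact tendsto_nhds_unique this (tendsto_const_nhds.congr fun n => (hZ (σ n)).symm)

/-- One of the two orientations occurs infinitely often. -/
theorem IsPiece.of_tendsto {Z : ℂ} {α β e : ℕ → ℝ} {α₀ β₀ e₀ : ℝ}
    (h : ∀ n, IsPiece Z (α n) (β n) (e n)) (hα : Tendsto α atTop (𝓝 α₀))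
    (hβ : Tendsto β atTop (𝓝 β₀)) (he : Tendsto e atTop (𝓝 e₀)) : IsPiece Z α₀ β₀ e₀ := by
  by_cases hf : ∃ᶠ n in atTop, IsUpDown Z (α n) (β n) (e n)
  · obtain ⟨σ, hσ, hu⟩ := extraction_of_frequently_atTop hf
    have hσt := hσ.tendsto_atTop
    exact Or.inl (IsUpDown.of_tendsto hu (hα.comp hσt) (hβ.comp hσt) (he.comp hσt))
  · have hf' : ∀ᶠ n in atTop, IsUpDown ((starRingEnd ℂ) Z) (-α n) (-β n) (e n) := by
      filter_upwards [not_frequently.mp hf] with n hn using (h n).resolve_left hn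
    obtain ⟨σ, hσ, hu⟩ := extraction_of_frequently_atTop hf'.frequently
    have hσt := hσ.tendsto_atTop
    exact Or.inr (IsUpDown.of_tendsto hu (hα.comp hσt).neg (hβ.comp hσt).neg (he.comp hσt))

/-- `β - α` is the difference of `M - α` and `M - β`, both in `[0, π]`. -/
theorem IsUpDown.abs_sub_le {Z : ℂ} {α β e : ℝ} (h : IsUpDown Z α β e) : |β - α| ≤ Real.pi := by
  obtain ⟨M, L₁, L₂, W₁, W₂, e₁, e₂, h₁, h₂, hp₁, hp₂, -, -⟩ := h
  have c1 := h₁.turning_nonneg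
  have c2 := h₂.turning_nonneg
  exact abs_le.mpr ⟨by linarith, by linarith⟩

theorem IsPiece.abs_sub_le {Z : ℂ} {α β e : ℝ} (h : IsPiece Z α β e) : |β - α| ≤ Real.pi := by
  rcases h with h | h
  · exact h.abs_sub_le
  · have := h.abs_sub_le
    rwa [neg_sub_neg, abs_sub_comm] at this

theorem IsUpDown.energy_nonneg {Z : ℂ} {α β e : ℝ} (h : IsUpDown Z α β e) : 0 ≤ e := by
  obtain ⟨M, L₁, L₂, W₁, W₂, e₁, e₂, h₁, h₂, -, -, -, he⟩ := h
  linarith [h₁.energy_nonneg, h₂.energy_nonneg]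

theorem IsPiece.energy_nonneg {Z : ℂ} {α β e : ℝ} (h : IsPiece Z α β e) : 0 ≤ e :=
  h.elim (fun h => h.energy_nonneg) fun h => h.energy_nonneg

/-- Let both halves turn by exactly `π`. Then `ψ = 0` is the only parameter in `exists_short_arcs`,
and its positivity hypothesis is the one given here. -/
theorem exists_isUpDown {Z : ℂ} {γ : ℝ} (h : 0 < (Z * Complex.exp (-(γ * Complex.I))).im) :
    ∃ e, IsUpDown Z γ γ e := by
  set W : ℂ := -(starRingEnd ℂ) (Z * Complex.exp (-(γ * Complex.I))) with hWdef
  have hpi := Real.pi_pos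
  obtain ⟨ψ, -, L₀, L₁, W₀, W₁, e₀, e₁, h₀, h₁, hW, -, -⟩ :=
    exists_short_arcs (φ₀ := Real.pi) (φ₁ := Real.pi) (W := W) (right_mem_Icc.mpr hpi.le)
      (by linarith) le_rfl (by
        intro ψ hψ
        rw [sub_self, Icc_self, mem_singleton_iff] at hψ
        subst hψ
        simpa [hWdef, add_comm] using h)
  refine ⟨e₀ + e₁, γ + Real.pi, L₀, L₁, W₀, W₁, e₀, e₁, by simpa using h₀, by simpa using h₁,
    by simp, by simp, ?_, le_rfl⟩
  have h2 : Complex.exp ((γ + Real.pi : ℝ) * Complex.I) = -Complex.exp (γ * Complex.I) := by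
    rw [← Complex.exp_add_pi_mul_I]
    congr 1
    push_cast
    ring
  rw [hW, hWdef, h2, map_neg, Complex.conj_conj, neg_mul_neg, mul_left_comm, ← Complex.exp_add]
  simp

/-- The side of the direction `γ` on which `Z` lies decides the orientation. -/
theorem exists_isPiece {Z : ℂ} {γ : ℝ} (h : (Z * Complex.exp (-(γ * Complex.I))).im ≠ 0) :
    ∃ e, IsPiece Z γ γ e := by
  rcases h.lt_or_gt with h | h
  · have h2 : 0 < ((starRingEnd ℂ) Z * Complex.exp (-((-γ : ℝ) * Complex.I))).im := by
      have h3 : (starRingEnd ℂ) Z * Complex.exp (-((-γ : ℝ) * Complex.I)) =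
          (starRingEnd ℂ) (Z * Complex.exp (-(γ * Complex.I))) := by
        simp [← Complex.exp_conj]
      rw [h3, Complex.conj_im]
      linarith
    obtain ⟨e, he⟩ := exists_isUpDown h2
    exact ⟨e, Or.inr he⟩
  · obtain ⟨e, he⟩ := exists_isUpDown h
    exact ⟨e, Or.inl he⟩

/-- A direction that is not parallel to any of countably many given nonzero vectors. -/
theorem exists_generic_angle {ι : Type*} [Countable ι] (Z : ι → ℂ) (hZ : ∀ i, Z i ≠ 0) :
    ∃ γ : ℝ, ∀ i, (Z i * Complex.exp (-(γ * Complex.I))).im ≠ 0 := by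
  have hcount : (⋃ i, ⋃ k : ℤ, {(Z i).arg - k * Real.pi} : Set ℝ).Countable :=
    countable_iUnion fun i => countable_iUnion fun k => countable_singleton _
  obtain ⟨γ, hγ⟩ : ∃ γ, γ ∉ (⋃ i, ⋃ k : ℤ, {(Z i).arg - k * Real.pi} : Set ℝ) := by
    by_contra hcon
    push Not at hcon
    exact not_countable_univ (hcount.mono fun x _ => hcon x)
  refine ⟨γ, fun i h0 => hγ ?_⟩
  have h1 : Z i * Complex.exp (-(γ * Complex.I)) =
      ‖Z i‖ * Complex.exp (((Z i).arg - γ : ℝ) * Complex.I) := by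
    conv_lhs => rw [← Complex.norm_mul_exp_arg_mul_I (Z i)]
    rw [mul_assoc, ← Complex.exp_add]
    congr 2
    push_cast
    ring
  rw [h1, Complex.im_ofReal_mul, Complex.exp_ofReal_mul_I_im, mul_eq_zero] at h0
  obtain ⟨k, hk⟩ := Real.sin_eq_zero_iff.mp (h0.resolve_left (norm_ne_zero_iff.mpr (hZ i)))
  simp only [mem_iUnion, mem_singleton_iff]
  exact ⟨i, k, by linarith⟩

/-! ### Gluing pieces into one curvature function -/

/-- On `[x, y]` the curvature `K` is first of one sign and then of the opposite sign, and both parts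
turn by at most `π`. -/
def IsSTurning (K : ℝ → ℝ) (x y : ℝ) : Prop :=
  ∃ c ∈ Icc x y, |tangentAngle K c - tangentAngle K x| ≤ Real.pi ∧
    |tangentAngle K y - tangentAngle K c| ≤ Real.pi ∧
    (((∀ᵐ s, s ∈ Ioo x c → 0 ≤ K s) ∧ ∀ᵐ s, s ∈ Ioo c y → K s ≤ 0) ∨
      ((∀ᵐ s, s ∈ Ioo x c → K s ≤ 0) ∧ ∀ᵐ s, s ∈ Ioo c y → 0 ≤ K s))

theorem tangentAngle_neg (K : ℝ → ℝ) (s : ℝ) : tangentAngle (-K) s = -tangentAngle K s :=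
  intervalIntegral.integral_neg

theorem displacement_neg (K : ℝ → ℝ) {s : ℝ} (hs : 0 ≤ s) :
    displacement (-K) s = (starRingEnd ℂ) (displacement K s) := by
  rw [displacement, displacement, intervalIntegral.integral_of_le hs,
    intervalIntegral.integral_of_le hs, ← integral_conj]
  refine integral_congr_ae (ae_of_all _ fun x => ?_)
  simp [tangentAngle_neg, ← Complex.exp_conj]

theorem IsSTurning.neg {K : ℝ → ℝ} {x y : ℝ} (h : IsSTurning K x y) : IsSTurning (-K) x y := by
  obtain ⟨c, hc, h1, h2, h3⟩ := h
  refine ⟨c, hc, ?_, ?_, ?_⟩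
  · simpa only [tangentAngle_neg, neg_sub_neg, abs_sub_comm] using h1
  · simpa only [tangentAngle_neg, neg_sub_neg, abs_sub_comm] using h2
  · simpa only [Pi.neg_apply, neg_nonneg, neg_nonpos] using h3.symm

theorem IsSTurning.glue_left {K₁ K₂ : ℝ → ℝ} {x y L : ℝ} (h : IsSTurning K₁ x y) (hL : 0 ≤ L)
    (hy : y ≤ L) : IsSTurning (glue L K₁ K₂) x y := by
  obtain ⟨c, hc, h1, h2, h3⟩ := h
  have hK : ∀ s ≤ L, glue L K₁ K₂ s = K₁ s := fun s hs => if_pos hs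
  have hΘ : ∀ s ≤ L, tangentAngle (glue L K₁ K₂) s = tangentAngle K₁ s := fun s hs =>
    tangentAngle_glue_of_le K₁ K₂ hL hs
  have hcL : c ≤ L := hc.2.trans hy
  refine ⟨c, hc, ?_, ?_, h3.imp ?_ ?_⟩
  · rwa [hΘ c hcL, hΘ x (hc.1.trans hcL)]
  · rwa [hΘ c hcL, hΘ y hy]
  all_goals
    rintro ⟨a, b⟩
    constructor
    · filter_upwards [a] with s hs hs'
      rw [hK s (hs'.2.le.trans hcL)]
      exact hs hs'
    · filter_upwards [b] with s hs hs'
      rw [hK s (hs'.2.le.trans hy)]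
      exact hs hs'

theorem IsSTurning.glue_right {K₁ K₂ : ℝ → ℝ} (h₁ : MemLp K₁ 2 volume) (h₂ : MemLp K₂ 2 volume)
    {y L : ℝ} (h : IsSTurning K₂ 0 y) (hL : 0 ≤ L) : IsSTurning (glue L K₁ K₂) L (L + y) := by
  obtain ⟨c, hc, h1, h2, h3⟩ := h
  have hK : ∀ s, L < s → glue L K₁ K₂ s = K₂ (s - L) := fun s hs => if_neg (not_le.mpr hs)
  have hΘ : ∀ s, 0 ≤ s → tangentAngle (glue L K₁ K₂) (L + s) = tangentAngle K₁ L + tangentAngle K₂ s :=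
    fun s hs => tangentAngle_glue_add h₁ h₂ hL hs
  have hΘL : tangentAngle (glue L K₁ K₂) L = tangentAngle K₁ L :=
    tangentAngle_glue_of_le K₁ K₂ hL le_rfl
  rw [tangentAngle_zero, sub_zero] at h1
  have hq := (measurePreserving_sub_right volume L).quasiMeasurePreserving
  refine ⟨L + c, ⟨by linarith [hc.1], by linarith [hc.2]⟩, ?_, ?_, h3.imp ?_ ?_⟩
  · rwa [hΘ c hc.1, hΘL, add_sub_cancel_left]
  · rwa [hΘ c hc.1, hΘ y (hc.1.trans hc.2), add_sub_add_left_eq_sub]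
  all_goals
    rintro ⟨a, b⟩
    constructor
    · filter_upwards [hq.ae a] with s hs hs'
      rw [hK s hs'.1]
      exact hs ⟨by linarith [hs'.1], by linarith [hs'.2]⟩
    · filter_upwards [hq.ae b] with s hs hs'
      rw [hK s (by linarith [hs'.1, hc.1])]
      exact hs ⟨by linarith [hs'.1], by linarith [hs'.2]⟩

/-- Both arcs start at the extremal angle `M`. Reversing the first restores the stretch from `α` up
to `M`; negating the curvature of the second gives the stretch down to `β`. -/
theorem IsUpDown.exists_curvature {Z : ℂ} {α β e : ℝ} (h : IsUpDown Z α β e) :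
    ∃ (L : ℝ) (K : ℝ → ℝ), 0 ≤ L ∧ MemLp K 2 volume ∧ tangentAngle K L = β - α ∧
      Complex.exp (α * Complex.I) * displacement K L = Z ∧ ∫ s, K s ^ 2 ≤ e ∧ IsSTurning K 0 L := by
  obtain ⟨M, L₁, L₂, W₁, W₂, e₁, e₂, h₁, h₂, hp₁, hp₂, hZ, he⟩ := h
  have hn₁ := h₁.turning_nonneg
  have hn₂ := h₂.turning_nonneg
  obtain ⟨hL₁, K₁, hK₁, hs₁, ha₁, hd₁, hE₁⟩ := h₁.reverse
  obtain ⟨hL₂, K₂, hK₂, hs₂, ha₂, hd₂, hE₂⟩ := h₂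
  have hg1 := tangentAngle_glue_of_le K₁ (-K₂) hL₁ le_rfl
  have hg2 := tangentAngle_glue_add hK₁ hK₂.neg hL₁ hL₂
  refine ⟨L₁ + L₂, glue L₁ K₁ (-K₂), by positivity, memLp_glue L₁ hK₁ hK₂.neg, ?_, ?_, ?_, L₁,
    ⟨hL₁, by linarith⟩, ?_, ?_, Or.inl ⟨?_, ?_⟩⟩
  · rw [hg2, ha₁, tangentAngle_neg, ha₂]
    ring
  · rw [displacement_glue_add hK₁ hK₂.neg hL₁ hL₂, displacement_neg K₂ hL₂, hd₁, hd₂, ha₁, ← hZ,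
      ← mul_add, ← mul_assoc, ← Complex.exp_add, map_add]
    congr 2
    push_cast
    ring
  · refine (integral_sq_glue_le L₁ hK₁ hK₂.neg).trans ?_
    simp only [Pi.neg_apply, neg_sq]
    linarith
  · rw [hg1, tangentAngle_zero, ha₁, sub_zero, abs_of_nonneg hn₁]
    exact hp₁
  · rw [hg1, hg2, tangentAngle_neg, ha₂, add_sub_cancel_left, abs_neg, abs_of_nonneg hn₂]
    exact hp₂
  · filter_upwards [hs₁] with s hs hs'
    rwa [glue, if_pos hs'.2.le]
  · filter_upwards [(measurePreserving_sub_right volume L₁).quasiMeasurePreserving.ae hs₂]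
      with s hs hs'
    rw [glue, if_neg (not_le.mpr hs'.1)]
    simpa using hs

theorem IsPiece.exists_curvature {Z : ℂ} {α β e : ℝ} (h : IsPiece Z α β e) :
    ∃ (L : ℝ) (K : ℝ → ℝ), 0 ≤ L ∧ MemLp K 2 volume ∧ tangentAngle K L = β - α ∧
      Complex.exp (α * Complex.I) * displacement K L = Z ∧ ∫ s, K s ^ 2 ≤ e ∧ IsSTurning K 0 L := by
  rcases h with h | h
  · exact h.exists_curvature
  · obtain ⟨L, K, hL, hK, ha, hd, he, hs⟩ := h.exists_curvature
    refine ⟨L, -K, hL, hK.neg, ?_, ?_, by simpa using he, hs.neg⟩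
    · rw [tangentAngle_neg, ha]
      ring
    · have := congrArg (starRingEnd ℂ) hd
      rw [Complex.conj_conj, map_mul, ← displacement_neg K hL, ← Complex.exp_conj] at this
      simpa using this

/-- Concatenation of a chain of s-shaped paths with matching tangent angles. -/
theorem exists_curvature_of_chain (m : ℕ) (Z : ℕ → ℂ) (α e : ℕ → ℝ) (hZ : ∀ i < m, Z i ≠ 0)
    (h : ∀ i < m, IsPiece (Z i) (α i) (α (i + 1)) (e i)) :
    ∃ (K : ℝ → ℝ) (t : ℕ → ℝ), MemLp K 2 volume ∧ t 0 = 0 ∧ StrictMono t ∧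
      tangentAngle K (t m) = α m - α 0 ∧
      (∀ i ≤ m, Complex.exp (α 0 * Complex.I) * displacement K (t i) =
        ∑ j ∈ Finset.range i, Z j) ∧
      ∫ s, K s ^ 2 ≤ ∑ i ∈ Finset.range m, e i ∧ ∀ i < m, IsSTurning K (t i) (t (i + 1)) := by
  induction m with
  | zero =>
    refine ⟨0, fun i => i, MemLp.zero, by simp, Nat.strictMono_cast, ?_, ?_, by simp, by simp⟩
    · simp [tangentAngle]
    · simp [displacement]
  | succ m ih =>
    obtain ⟨K₁, t, hK₁, ht0, ht, ha₁, hd₁, hE₁, hs₁⟩ := ih (fun i hi => hZ i (by omega))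
      fun i hi => h i (by omega)
    obtain ⟨L, K₂, hL, hK₂, ha₂, hd₂, hE₂, hs₂⟩ := (h m (by omega)).exists_curvature
    -- A nonzero chord excludes a piece of length zero, so the node parameters increase strictly.
    have hLpos : 0 < L := by
      refine lt_of_le_of_ne hL ?_
      rintro rfl
      exact hZ m (by omega) (by simp [← hd₂, displacement])
    have htm : 0 ≤ t m := ht0 ▸ ht.monotone (Nat.zero_le m)
    -- Only the value `t m + L` at `m + 1` matters; the affine continuation keeps the sequence
    -- strictly increasing on all of `ℕ`.
    set t' : ℕ → ℝ := fun i => if i ≤ m then t i else t m + L * ((i : ℝ) - m) with ht'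
    have ht'1 : ∀ i ≤ m, t' i = t i := fun i hi => if_pos hi
    have ht'2 : t' (m + 1) = t m + L := by simp [ht']
    refine ⟨glue (t m) K₁ K₂, t', memLp_glue _ hK₁ hK₂, by rw [ht'1 0 (Nat.zero_le m), ht0],
      strictMono_nat_of_lt_succ fun i => ?_, ?_, ?_, ?_, ?_⟩
    · simp only [ht']
      split_ifs with h1 h2 h2
      · exact ht (Nat.lt_succ_self i)
      · have : i = m := by omega
        subst this
        push_cast
        linarith
      · omega
      · push_cast
        linarith
    · rw [ht'2, tangentAngle_glue_add hK₁ hK₂ htm hL, ha₁, ha₂]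
      ring
    · intro i hi
      rcases Nat.lt_or_ge m i with h1 | h1
      · have : i = m + 1 := by omega
        subst this
        rw [ht'2, displacement_glue_add hK₁ hK₂ htm hL, mul_add, hd₁ m le_rfl,
          Finset.sum_range_succ, ← hd₂, ha₁, ← mul_assoc, ← Complex.exp_add]
        congr 3
        push_cast
        ring
      · rw [ht'1 i h1, displacement_glue_of_le K₁ K₂ htm (ht.monotone h1), hd₁ i h1]
    · rw [Finset.sum_range_succ]
      exact (integral_sq_glue_le _ hK₁ hK₂).trans (add_le_add hE₁ hE₂)
    · intro i hi
      rcases Nat.lt_or_ge i m with h1 | h1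
      · rw [ht'1 i h1.le, ht'1 (i + 1) h1]
        exact (hs₁ i h1).glue_left htm (ht.monotone h1)
      · have : i = m := by omega
        subst this
        rw [ht'1 i le_rfl, ht'2]
        exact hs₂.glue_right hK₁ hK₂ htm

theorem AbsolutelyContinuousOnInterval.congr {X : Type*} [PseudoMetricSpace X] {f g : ℝ → X}
    {a b : ℝ} (hf : AbsolutelyContinuousOnInterval f a b) (h : EqOn f g (uIcc a b)) :
    AbsolutelyContinuousOnInterval g a b := by
  rw [absolutelyContinuousOnInterval_iff] at hf ⊢
  intro ε hε
  obtain ⟨δ, hδ, H⟩ := hf ε hε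
  refine ⟨δ, hδ, fun E hE hlt => (le_of_eq ?_).trans_lt (H E hE hlt)⟩
  refine Finset.sum_congr rfl fun i hi => ?_
  rw [h (hE.1 i hi).1, h (hE.1 i hi).2]

theorem lipschitzWith_exp_ofReal_mul_I :
    LipschitzWith 1 fun x : ℝ => Complex.exp (x * Complex.I) := by
  have hd : ∀ x : ℝ, HasDerivAt (fun x : ℝ => Complex.exp (x * Complex.I))
      (Complex.exp (x * Complex.I) * Complex.I) x := by
    intro x
    have := ((Complex.ofRealCLM.hasDerivAt (x := x)).mul_const Complex.I).cexp
    simpa using this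
  refine lipschitzWith_of_nnnorm_deriv_le (fun x => (hd x).differentiableAt) fun x => ?_
  rw [(hd x).deriv, ← NNReal.coe_le_coe, coe_nnnorm, norm_mul, Complex.norm_exp_ofReal_mul_I]
  simp

/-! ### From curvature functions to admissible curves -/

/-- The arclength-parametrized planar curve with curvature `K`, starting at `p` with tangent
angle `α`. -/
noncomputable def curveOfCurvature (p : ℂ) (α : ℝ) (K : ℝ → ℝ) (s : ℝ) : ℂ :=
  p + Complex.exp (α * Complex.I) * displacement K s

section curveOfCurvature

variable {K : ℝ → ℝ} (p : ℂ) (α : ℝ)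

theorem hasDerivAt_curveOfCurvature (hK : MemLp K 2 volume) (s : ℝ) :
    HasDerivAt (curveOfCurvature p α K) (Complex.exp ((α + tangentAngle K s : ℝ) * Complex.I)) s := by
  have hc := continuous_tangent hK
  have h : HasDerivAt (displacement K) (Complex.exp (tangentAngle K s * Complex.I)) s :=
    intervalIntegral.integral_hasDerivAt_right (hc.intervalIntegrable _ _)
      (hc.stronglyMeasurableAtFilter _ _) hc.continuousAt
  have h2 := (h.const_mul (Complex.exp (α * Complex.I))).const_add p
  rw [← Complex.exp_add, ← add_mul, ← Complex.ofReal_add] at h2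
  exact h2

theorem deriv_curveOfCurvature (hK : MemLp K 2 volume) :
    deriv (curveOfCurvature p α K) =
      fun s => Complex.exp ((α + tangentAngle K s : ℝ) * Complex.I) :=
  funext fun s => (hasDerivAt_curveOfCurvature p α hK s).deriv

theorem isCurve_curveOfCurvature (hK : MemLp K 2 volume) {x y : ℝ} (hxy : x < y) :
    IsCurve (curveOfCurvature p α K) x y := by
  have hd := hasDerivAt_curveOfCurvature p α hK
  have hw : ∀ t ∈ Icc x y, derivWithin (curveOfCurvature p α K) (Icc x y) t =
      Complex.exp ((α + tangentAngle K t : ℝ) * Complex.I) := fun t ht =>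
    (hd t).hasDerivWithinAt.derivWithin (uniqueDiffOn_Icc hxy t ht)
  refine ⟨hxy, fun t _ => (hd t).differentiableAt.differentiableWithinAt, ?_, fun t ht => ?_⟩
  · have h1 : AbsolutelyContinuousOnInterval (fun t => α + tangentAngle K t) x y :=
      AbsolutelyContinuousOnInterval.fun_add
        (LipschitzWith.const α).lipschitzOnWith.absolutelyContinuousOnInterval
        hK.absolutelyContinuous_tangentAngle
    refine (lipschitzWith_exp_ofReal_mul_I.comp_absolutelyContinuousOnInterval h1).congr
      fun t ht => ?_
    rw [uIcc_of_le hxy.le] at ht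
    exact (hw t ht).symm
  · rw [hw t ht]
    exact Complex.exp_ne_zero _

theorem norm_deriv_curveOfCurvature (hK : MemLp K 2 volume) (s : ℝ) :
    ‖deriv (curveOfCurvature p α K) s‖ = 1 := by
  rw [deriv_curveOfCurvature p α hK, Complex.norm_exp_ofReal_mul_I]

theorem ae_signedCurvature_curveOfCurvature (hK : MemLp K 2 volume) :
    ∀ᵐ s, signedCurvature (curveOfCurvature p α K) s = K s := by
  filter_upwards [ae_hasDerivAt_tangentAngle hK] with s hs
  have hd := hasDerivAt_curveOfCurvature p α hK
  have hang : HasDerivAt (fun s => α + tangentAngle K s) (K s) s := hs.const_add α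
  have hne : deriv (curveOfCurvature p α K) s ≠ 0 := by
    rw [(hd s).deriv]
    exact Complex.exp_ne_zero _
  have h2 : DifferentiableAt ℝ (deriv (curveOfCurvature p α K)) s := by
    rw [deriv_curveOfCurvature p α hK]
    exact (hang.ofReal_comp.mul_const Complex.I).cexp.differentiableAt
  rw [signedCurvature_eq_of_directionAngle hne h2 hang.differentiableAt, hang.deriv,
    norm_deriv_curveOfCurvature p α hK, div_one]
  refine Eventually.of_forall fun x => ?_
  rw [norm_deriv_curveOfCurvature p α hK, (hd x).deriv, Complex.ofReal_one, one_mul, mul_comm]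

theorem turningAngle_curveOfCurvature (hK : MemLp K 2 volume) (x y : ℝ) :
    turningAngle (curveOfCurvature p α K) x y = tangentAngle K y - tangentAngle K x := by
  rw [tangentAngle_sub hK, turningAngle]
  refine intervalIntegral.integral_congr_ae ?_
  filter_upwards [ae_signedCurvature_curveOfCurvature p α hK] with s hs _
  rw [hs, norm_deriv_curveOfCurvature p α hK, mul_one]

theorem bendingEnergy_curveOfCurvature_le (hK : MemLp K 2 volume) (x y : ℝ) :
    bendingEnergy (curveOfCurvature p α K) x y ≤ (1 / 4) * ENNReal.ofReal (∫ s, K s ^ 2) := by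
  refine mul_le_mul_right (le_trans (setLIntegral_le_lintegral _ _) (le_of_eq ?_)) _
  rw [ofReal_integral_eq_lintegral_ofReal hK.integrable_sq (ae_of_all _ fun s => sq_nonneg _)]
  refine lintegral_congr_ae ?_
  filter_upwards [ae_signedCurvature_curveOfCurvature p α hK] with s hs
  rw [hs, norm_deriv_curveOfCurvature p α hK, mul_one]

theorem isLeftCCurve_curveOfCurvature (hK : MemLp K 2 volume) {x y : ℝ} (hxy : x < y)
    (h : ∀ᵐ s, s ∈ Ioo x y → 0 ≤ K s) (hπ : |tangentAngle K y - tangentAngle K x| ≤ Real.pi) :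
    IsLeftCCurve (curveOfCurvature p α K) x y := by
  refine ⟨⟨isCurve_curveOfCurvature p α hK hxy, ?_⟩, ?_⟩
  · rw [← restrict_Ioo_eq_restrict_Icc, ae_restrict_iff' measurableSet_Ioo]
    filter_upwards [h, ae_signedCurvature_curveOfCurvature p α hK] with s hs hκ hs'
    rw [hκ]
    exact hs hs'
  · rwa [turningAngle_curveOfCurvature p α hK]

theorem isRightCCurve_curveOfCurvature (hK : MemLp K 2 volume) {x y : ℝ} (hxy : x < y)
    (h : ∀ᵐ s, s ∈ Ioo x y → K s ≤ 0) (hπ : |tangentAngle K y - tangentAngle K x| ≤ Real.pi) :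
    IsRightCCurve (curveOfCurvature p α K) x y := by
  refine ⟨⟨isCurve_curveOfCurvature p α hK hxy, ?_⟩, ?_⟩
  · rw [← restrict_Ioo_eq_restrict_Icc, ae_restrict_iff' measurableSet_Ioo]
    filter_upwards [h, ae_signedCurvature_curveOfCurvature p α hK] with s hs hκ hs'
    rw [hκ]
    exact hs hs'
  · rwa [turningAngle_curveOfCurvature p α hK]

/-- The sign change of an s-turning may lie at an end of the interval; the curve is then a single
c-curve. -/
theorem isSCurve_curveOfCurvature (hK : MemLp K 2 volume) {x y : ℝ} (hxy : x < y)
    (h : IsSTurning K x y) : IsSCurve (curveOfCurvature p α K) x y := by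
  obtain ⟨c, hc, h1, h2, h3⟩ := h
  rcases hc.1.eq_or_lt with rfl | hxc
  · left
    rcases h3 with ⟨-, h3⟩ | ⟨-, h3⟩
    · exact Or.inr (isRightCCurve_curveOfCurvature p α hK hxy h3 h2)
    · exact Or.inl (isLeftCCurve_curveOfCurvature p α hK hxy h3 h2)
  rcases hc.2.eq_or_lt with rfl | hcy
  · left
    rcases h3 with ⟨h3, -⟩ | ⟨h3, -⟩
    · exact Or.inl (isLeftCCurve_curveOfCurvature p α hK hxy h3 h1)
    · exact Or.inr (isRightCCurve_curveOfCurvature p α hK hxy h3 h1)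
  refine Or.inr ⟨isCurve_curveOfCurvature p α hK hxy, c, ⟨hxc, hcy⟩, h3.imp ?_ ?_⟩
  · rintro ⟨a, b⟩
    exact ⟨isLeftCCurve_curveOfCurvature p α hK hxc a h1,
      isRightCCurve_curveOfCurvature p α hK hcy b h2⟩
  · rintro ⟨a, b⟩
    exact ⟨isRightCCurve_curveOfCurvature p α hK hxc a h1,
      isLeftCCurve_curveOfCurvature p α hK hcy b h2⟩

end curveOfCurvature

/-- A chain of s-shaped paths with matching tangent angles is realized by an admissible curve. -/
theorem exists_isAdmissible_of_chain {m : ℕ} (hm : 1 ≤ m) (P : Fin (m + 1) → ℂ)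
    (hP : ∀ i : Fin m, P i.castSucc ≠ P i.succ) (α : Fin (m + 1) → ℝ) (e : Fin m → ℝ)
    (h : ∀ i : Fin m, IsPiece (P i.succ - P i.castSucc) (α i.castSucc) (α i.succ) (e i)) :
    ∃ (f : ℝ → ℂ) (a b : ℝ), IsAdmissible P f a b ∧
      bendingEnergy f a b ≤ (1 / 4) * ENNReal.ofReal (∑ i, e i) := by
  set P' : ℕ → ℂ := fun i => if hi : i < m + 1 then P ⟨i, hi⟩ else 0 with hP'
  set α' : ℕ → ℝ := fun i => if hi : i < m + 1 then α ⟨i, hi⟩ else 0 with hα'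
  set e' : ℕ → ℝ := fun i => if hi : i < m then e ⟨i, hi⟩ else 0 with he'
  have hPv : ∀ i : Fin (m + 1), P' i = P i := fun i => dif_pos i.2
  have hαv : ∀ i : Fin (m + 1), α' i = α i := fun i => dif_pos i.2
  have hev : ∀ i : Fin m, e' i = e i := fun i => dif_pos i.2
  obtain ⟨K, t, hK, ht0, ht, -, hd, hE, hs⟩ := exists_curvature_of_chain m
    (fun i => P' (i + 1) - P' i) α' e'
    (fun i hi => by
      have h1 := hP ⟨i, hi⟩
      rw [← hPv, ← hPv] at h1
      exact sub_ne_zero.mpr h1.symm)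
    (fun i hi => by
      have h1 := h ⟨i, hi⟩
      rw [← hPv, ← hPv, ← hαv, ← hαv, ← hev] at h1
      exact h1)
  have hlt : t 0 < t m := ht (by omega)
  refine ⟨curveOfCurvature (P' 0) (α' 0) K, t 0, t m,
    ⟨isCurve_curveOfCurvature _ _ hK hlt, fun i => t i, ht.comp Fin.val_strictMono, ?_, ?_, ?_, ?_⟩,
    ?_⟩
  · intro i hi
    simp only [hi]
  · intro i hi
    have : (i : ℕ) = m := by omega
    simp only [this]
  · intro i
    rw [curveOfCurvature, hd i (by omega), Finset.sum_range_sub, ← hPv]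
    ring
  · intro i j hij
    have := hs i (by omega)
    beta_reduce
    rw [hij]
    exact isSCurve_curveOfCurvature _ _ hK (ht (Nat.lt_succ_self i)) this
  · refine (bendingEnergy_curveOfCurvature_le _ _ hK _ _).trans ?_
    gcongr
    rw [← Fin.sum_univ_eq_sum_range] at hE
    simpa only [hev] using hE

/-! ### From admissible curves to pieces: the polar form -/

/-- The curve `F` on `[a, b]` has speed `v`, direction angle `θ`, angular speed `k`, and square
integrable curvature. -/
structure IsPolarCurve (F : ℝ → ℂ) (θ v k : ℝ → ℝ) (a b : ℝ) : Prop where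
  continuousOn_speed : ContinuousOn v (Icc a b)
  speed_pos : ∀ t ∈ Icc a b, 0 < v t
  integrable_turning : IntervalIntegrable k volume a b
  integrable_energy : IntervalIntegrable (fun t => k t ^ 2 / v t) volume a b
  angle_sub : ∀ x ∈ Icc a b, ∀ y ∈ Icc a b, θ y - θ x = ∫ t in x..y, k t
  sub_eq : ∀ x ∈ Icc a b, ∀ y ∈ Icc a b,
    F y - F x = ∫ t in x..y, v t * Complex.exp (θ t * Complex.I)

namespace IsPolarCurve

variable {F : ℝ → ℂ} {θ v k : ℝ → ℝ} {a b x y c : ℝ}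

theorem conj (h : IsPolarCurve F θ v k a b) :
    IsPolarCurve (fun t => (starRingEnd ℂ) (F t)) (fun t => -θ t) v (fun t => -k t) a b where
  continuousOn_speed := h.continuousOn_speed
  speed_pos := h.speed_pos
  integrable_turning := h.integrable_turning.neg
  integrable_energy := by simpa using h.integrable_energy
  angle_sub x hx y hy := by
    rw [intervalIntegral.integral_neg, ← h.angle_sub x hx y hy]
    ring
  sub_eq x hx y hy := by
    rw [← map_sub, h.sub_eq x hx y hy, intervalIntegral.intervalIntegral_eq_integral_uIoc,
      intervalIntegral.intervalIntegral_eq_integral_uIoc, RCLike.conj_smul, ← integral_conj]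
    congr 1
    refine integral_congr_ae (ae_of_all _ fun t => ?_)
    simp [← Complex.exp_conj]

theorem mono (h : IsPolarCurve F θ v k a b) (hx : x ∈ Icc a b) (hy : y ∈ Icc a b) (hxy : x ≤ y) :
    IsPolarCurve F θ v k x y := by
  have hsub : Icc x y ⊆ Icc a b := Icc_subset_Icc hx.1 hy.2
  have hsub' : uIcc x y ⊆ uIcc a b := by
    rwa [uIcc_of_le hxy, uIcc_of_le (hx.1.trans hx.2)]
  exact ⟨h.continuousOn_speed.mono hsub, fun t ht => h.speed_pos t (hsub ht),
    h.integrable_turning.mono_set hsub', h.integrable_energy.mono_set hsub',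
    fun s hs t ht => h.angle_sub s (hsub hs) t (hsub ht),
    fun s hs t ht => h.sub_eq s (hsub hs) t (hsub ht)⟩

theorem exists_isArc (h : IsPolarCurve F θ v k x y) (hxy : x ≤ y)
    (hk : ∀ᵐ t, t ∈ Ioo x y → 0 ≤ k t) :
    ∃ L, IsArc L (θ y - θ x) (Complex.exp (-(θ x * Complex.I)) * (F y - F x))
      (∫ t in x..y, k t ^ 2 / v t) := by
  rcases hxy.eq_or_lt with rfl | hlt
  · exact ⟨0, by simpa using isArc_line le_rfl⟩
  have hx := left_mem_Icc.mpr hxy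
  have hy := right_mem_Icc.mpr hxy
  refine ⟨∫ t in x..y, v t, ?_⟩
  have := isArc_of_speed hlt (h.continuousOn_speed.mono Ioo_subset_Icc_self)
    (fun t ht => h.speed_pos t (Ioo_subset_Icc_self ht))
    (h.continuousOn_speed.intervalIntegrable_of_Icc hxy) h.integrable_turning hk h.integrable_energy
  rw [← h.angle_sub x hx y hy] at this
  convert this using 1
  rw [h.sub_eq x hx y hy, ← intervalIntegral.integral_const_mul]
  refine intervalIntegral.integral_congr fun t ht => ?_
  rw [uIcc_of_le hxy] at ht
  simp only [← h.angle_sub x hx t ht]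
  rw [mul_left_comm, ← Complex.exp_add]
  congr 2
  push_cast
  ring

theorem isUpDown (h : IsPolarCurve F θ v k a b) (hx : x ∈ Icc a b) (hy : y ∈ Icc a b)
    (hc : c ∈ Icc x y) (h1 : ∀ᵐ t, t ∈ Ioo x c → 0 ≤ k t) (h2 : ∀ᵐ t, t ∈ Ioo c y → k t ≤ 0)
    (hp1 : |∫ t in x..c, k t| ≤ Real.pi) (hp2 : |∫ t in c..y, k t| ≤ Real.pi) :
    IsUpDown (F y - F x) (θ x) (θ y) (∫ t in x..y, k t ^ 2 / v t) := by
  have hcm : c ∈ Icc a b := ⟨hx.1.trans hc.1, hc.2.trans hy.2⟩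
  obtain ⟨L₁, a₁⟩ := (h.mono hx hcm hc.1).exists_isArc hc.1 h1
  obtain ⟨L₂, a₂⟩ := ((h.mono hcm hy hc.2).conj).exists_isArc hc.2
    (by simpa only [neg_nonneg] using h2)
  have a₁' := a₁.reverse
  rw [← h.angle_sub x hx c hcm] at hp1
  rw [← h.angle_sub c hcm y hy] at hp2
  simp only [neg_sub_neg, neg_sq] at a₂
  -- The extremal angle is the one at the change of sign. The rising part is run backwards and the
  -- falling part reflected, so that both become left-turning arcs leaving `c`.
  refine ⟨θ c, L₁, L₂, _, _, _, _, a₁', a₂, le_of_abs_le hp1, ?_, ?_, le_of_eq ?_⟩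
  · rw [abs_sub_comm] at hp2
    exact le_of_abs_le hp2
  · have e1 : Complex.exp (θ c * Complex.I) *
        Complex.exp (-(((θ c - θ x : ℝ) : ℂ) * Complex.I)) * Complex.exp (-(θ x * Complex.I)) = 1 := by
      rw [← Complex.exp_add, ← Complex.exp_add, Complex.exp_eq_one_iff]
      refine ⟨0, ?_⟩
      push_cast
      ring
    have e2 : Complex.exp (θ c * Complex.I) * Complex.exp (-(θ c * Complex.I)) = 1 := by
      rw [← Complex.exp_add]
      simp
    simp only [map_add, map_mul, map_sub, Complex.conj_conj, ← Complex.exp_conj, map_neg,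
      Complex.conj_ofReal, Complex.conj_I, mul_neg, neg_neg, Complex.ofReal_neg, neg_mul]
    linear_combination (F c - F x) * e1 + (F y - F c) * e2
  · have i := fun (s t : ℝ) (hs : s ∈ Icc a b) (ht : t ∈ Icc a b) (hst : s ≤ t) =>
      (h.mono hs ht hst).integrable_energy
    exact intervalIntegral.integral_add_adjacent_intervals (i x c hx hcm hc.1) (i c y hcm hy hc.2)

theorem isPiece (h : IsPolarCurve F θ v k a b) (hx : x ∈ Icc a b) (hy : y ∈ Icc a b)
    (hc : c ∈ Icc x y) (hp1 : |∫ t in x..c, k t| ≤ Real.pi) (hp2 : |∫ t in c..y, k t| ≤ Real.pi)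
    (hk : ((∀ᵐ t, t ∈ Ioo x c → 0 ≤ k t) ∧ ∀ᵐ t, t ∈ Ioo c y → k t ≤ 0) ∨
      ((∀ᵐ t, t ∈ Ioo x c → k t ≤ 0) ∧ ∀ᵐ t, t ∈ Ioo c y → 0 ≤ k t)) :
    IsPiece (F y - F x) (θ x) (θ y) (∫ t in x..y, k t ^ 2 / v t) := by
  rcases hk with ⟨h1, h2⟩ | ⟨h1, h2⟩
  · exact Or.inl (h.isUpDown hx hy hc h1 h2 hp1 hp2)
  · have := h.conj.isUpDown hx hy hc (by simpa only [neg_nonneg] using h1)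
      (by simpa only [neg_nonpos] using h2)
      (by rwa [intervalIntegral.integral_neg, abs_neg])
      (by rwa [intervalIntegral.integral_neg, abs_neg])
    simp only [neg_sq] at this
    right
    rwa [map_sub]

end IsPolarCurve

theorem LipschitzOnWith.comp_absolutelyContinuousOnInterval {X Y : Type*} [PseudoMetricSpace X]
    [PseudoMetricSpace Y] {C : NNReal} {g : X → Y} {s : Set X} (hg : LipschitzOnWith C g s)
    {f : ℝ → X} {a b : ℝ} (hf : AbsolutelyContinuousOnInterval f a b)
    (hs : MapsTo f (uIcc a b) s) : AbsolutelyContinuousOnInterval (fun x => g (f x)) a b := by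
  rw [absolutelyContinuousOnInterval_iff] at hf ⊢
  intro ε hε
  obtain ⟨δ, hδ, H⟩ := hf (ε / (C + 1)) (by positivity)
  refine ⟨δ, hδ, fun E hE hlt => ?_⟩
  have h1 : ∑ i ∈ Finset.range E.1, dist (g (f (E.2 i).1)) (g (f (E.2 i).2)) ≤
      C * ∑ i ∈ Finset.range E.1, dist (f (E.2 i).1) (f (E.2 i).2) := by
    rw [Finset.mul_sum]
    exact Finset.sum_le_sum fun i hi => hg.dist_le_mul _ (hs (hE.1 i hi).1) _ (hs (hE.1 i hi).2)
  have h2 := H E hE hlt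
  rw [lt_div_iff₀ (by positivity)] at h2
  have h3 : 0 ≤ ∑ i ∈ Finset.range E.1, dist (f (E.2 i).1) (f (E.2 i).2) :=
    Finset.sum_nonneg fun i _ => dist_nonneg
  nlinarith

theorem ContDiff.comp_absolutelyContinuousOnInterval {E F : Type*} [NormedAddCommGroup E]
    [NormedSpace ℝ E] [ProperSpace E] [NormedAddCommGroup F] [NormedSpace ℝ F] {g : E → F}
    (hg : ContDiff ℝ 1 g) {f : ℝ → E} {a b : ℝ} (hf : AbsolutelyContinuousOnInterval f a b) :
    AbsolutelyContinuousOnInterval (fun x => g (f x)) a b := by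
  obtain ⟨C, hC⟩ := hf.exists_bound
  obtain ⟨K, hK⟩ := hg.contDiffOn.exists_lipschitzOnWith (s := Metric.closedBall 0 C) (by decide)
    (convex_closedBall 0 C) (isCompact_closedBall 0 C)
  exact hK.comp_absolutelyContinuousOnInterval hf fun x hx => by
    rw [mem_closedBall_zero_iff]
    exact hC x hx

theorem AbsolutelyContinuousOnInterval.complex_ae_hasDerivAt {D : ℝ → ℂ} {a b : ℝ}
    (hD : AbsolutelyContinuousOnInterval D a b) :
    ∀ᵐ t, t ∈ uIcc a b → HasDerivAt D (deriv D t) t := by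
  filter_upwards [hD.boundedVariationOn.ae_differentiableAt_of_mem_uIcc] with t ht h
  exact (ht h).hasDerivAt

theorem AbsolutelyContinuousOnInterval.intervalIntegrable_complex_deriv {D : ℝ → ℂ} {a b : ℝ}
    (hD : AbsolutelyContinuousOnInterval D a b) : IntervalIntegrable (deriv D) volume a b := by
  have hre : AbsolutelyContinuousOnInterval (fun t => (D t).re) a b :=
    Complex.reCLM.lipschitz.comp_absolutelyContinuousOnInterval hD
  have him : AbsolutelyContinuousOnInterval (fun t => (D t).im) a b :=
    Complex.imCLM.lipschitz.comp_absolutelyContinuousOnInterval hD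
  have i1 := hre.intervalIntegrable_deriv
  have i2 := him.intervalIntegrable_deriv
  have j1 : IntervalIntegrable (fun t => ((deriv (fun t => (D t).re) t : ℝ) : ℂ)) volume a b :=
    ⟨i1.1.ofReal, i1.2.ofReal⟩
  have j2 : IntervalIntegrable (fun t => ((deriv (fun t => (D t).im) t : ℝ) : ℂ)) volume a b :=
    ⟨i2.1.ofReal, i2.2.ofReal⟩
  refine (j1.add (j2.mul_const Complex.I)).congr_ae ?_
  rw [EventuallyEq, ae_restrict_iff' measurableSet_uIoc]
  filter_upwards [hD.complex_ae_hasDerivAt] with t ht h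
  have hd := ht (uIoc_subset_uIcc h)
  have r1 : HasDerivAt (fun t => (D t).re) (deriv D t).re t :=
    Complex.reCLM.hasFDerivAt.comp_hasDerivAt t hd
  have r2 : HasDerivAt (fun t => (D t).im) (deriv D t).im t :=
    Complex.imCLM.hasFDerivAt.comp_hasDerivAt t hd
  rw [r1.deriv, r2.deriv]
  exact Complex.re_add_im _

/-- A nowhere vanishing absolutely continuous complex function has an absolutely continuous
argument. -/
theorem AbsolutelyContinuousOnInterval.eq_norm_mul_exp {D : ℝ → ℂ} {a b : ℝ} (hab : a ≤ b)
    (hD : AbsolutelyContinuousOnInterval D a b) (hne : ∀ t ∈ Icc a b, D t ≠ 0) :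
    IntervalIntegrable (fun t => (deriv D t / D t).im) volume a b ∧ ∀ t ∈ Icc a b,
      D t = ‖D t‖ * Complex.exp (((D a).arg + ∫ x in a..t, (deriv D x / D x).im : ℝ) *
        Complex.I) := by
  have hDc : ContinuousOn D (uIcc a b) := hD.continuousOn
  have hq : IntervalIntegrable (fun t => deriv D t / D t) volume a b := by
    simp only [div_eq_mul_inv]
    exact hD.intervalIntegrable_complex_deriv.mul_continuousOn
      (hDc.inv₀ fun t ht => hne t (by rwa [uIcc_of_le hab] at ht))
  have qre : IntervalIntegrable (fun t => (deriv D t / D t).re) volume a b :=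
    ⟨hq.1.re, hq.2.re⟩
  have qim : IntervalIntegrable (fun t => (deriv D t / D t).im) volume a b :=
    ⟨hq.1.im, hq.2.im⟩
  refine ⟨qim, ?_⟩
  set R : ℝ → ℝ := fun t => ∫ x in a..t, (deriv D x / D x).re with hR
  set Θ : ℝ → ℝ := fun t => ∫ x in a..t, (deriv D x / D x).im with hΘ
  have aR := qre.absolutelyContinuousOnInterval_intervalIntegral (c := a) left_mem_uIcc
  have aΘ := qim.absolutelyContinuousOnInterval_intervalIntegral (c := a) left_mem_uIcc
  have aR' : AbsolutelyContinuousOnInterval (fun t => (R t : ℂ)) a b :=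
    Complex.ofRealCLM.lipschitz.comp_absolutelyContinuousOnInterval aR
  have aΘ' : AbsolutelyContinuousOnInterval (fun t => (Θ t : ℂ)) a b :=
    Complex.ofRealCLM.lipschitz.comp_absolutelyContinuousOnInterval aΘ
  -- `g` is a primitive of `D' / D`, a logarithm of `D` up to a constant: `exp (-g) * D` is
  -- absolutely continuous with derivative zero almost everywhere, hence constant.
  set g : ℝ → ℂ := fun t => R t + Complex.I • (Θ t : ℂ) with hg
  have ag : AbsolutelyContinuousOnInterval g a b := aR'.fun_add (aΘ'.const_smul Complex.I)
  have aw := ((Complex.contDiff_exp (𝕜 := ℝ) (n := 1)).comp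
    contDiff_neg).comp_absolutelyContinuousOnInterval ag
  have aw2 := aw.fun_smul hD
  obtain ⟨C, hC⟩ := aw2.const_of_ae_hasDerivAt_zero (by
    filter_upwards [hD.complex_ae_hasDerivAt, qre.ae_hasDerivAt_integral,
      qim.ae_hasDerivAt_integral] with t h1 h2 h3 ht
    have d1 := h1 ht
    have d2 : HasDerivAt (fun t => (R t : ℂ)) ((deriv D t / D t).re : ℂ) t :=
      (h2 ht a left_mem_uIcc).ofReal_comp
    have d3 : HasDerivAt (fun t => (Θ t : ℂ)) ((deriv D t / D t).im : ℂ) t :=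
      (h3 ht a left_mem_uIcc).ofReal_comp
    have d4 : HasDerivAt g (deriv D t / D t) t := by
      have := d2.add (d3.const_mul Complex.I)
      rw [mul_comm, Complex.re_add_im] at this
      exact this
    have d5 := (d4.neg.cexp).mul d1
    have hDt : D t ≠ 0 := hne t (by rwa [uIcc_of_le hab] at ht)
    have hz : Complex.exp ((-g) t) * -(deriv D t / D t) * D t +
        Complex.exp ((-g) t) * deriv D t = 0 := by
      field_simp
      ring
    rw [hz] at d5
    exact d5)
  have ga : g a = 0 := by simp [hg, hR, hΘ]
  intro t ht
  have e1 := hC a left_mem_uIcc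
  have e2 := hC t (by rwa [uIcc_of_le hab])
  simp only [Function.comp_apply, ga, neg_zero, Complex.exp_zero, one_mul,
    smul_eq_mul] at e1 e2
  have e3 : D t = D a * Complex.exp (g t) := by
    rw [e1, ← e2, mul_right_comm, ← Complex.exp_add]
    simp
  have e4 : Complex.exp (g t) = (Real.exp (R t) : ℂ) * Complex.exp (Θ t * Complex.I) := by
    rw [Complex.ofReal_exp, ← Complex.exp_add]
    simp only [hg, smul_eq_mul, mul_comm Complex.I]
  have e5 : ‖D t‖ = ‖D a‖ * Real.exp (R t) := by
    rw [e3, e4, norm_mul, norm_mul, Complex.norm_exp_ofReal_mul_I, mul_one, Complex.norm_real,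
      Real.norm_of_nonneg (Real.exp_nonneg _)]
  rw [e5, e3, e4]
  conv_lhs => rw [← Complex.norm_mul_exp_arg_mul_I (D a)]
  push_cast
  rw [add_mul, Complex.exp_add]
  ring

/-- The angle is the argument of the initial derivative plus the integral of `κ |f'|`. Its initial
value lies in `[-π, π]`, which normalizes the chains of competitors. -/
theorem IsCurve.isPolarCurve {f : ℝ → ℂ} {a b : ℝ} (hf : IsCurve f a b)
    (he : bendingEnergy f a b ≠ ⊤) :
    ∃ (θ v k : ℝ → ℝ), IsPolarCurve f θ v k a b ∧ θ a ∈ Icc (-Real.pi) Real.pi ∧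
      (∀ t, k t = signedCurvature f t * ‖deriv f t‖) ∧
      bendingEnergy f a b = (1 / 4) * ENNReal.ofReal (∫ t in a..b, k t ^ 2 / v t) := by
  obtain ⟨hab, hdiff, hD, hne⟩ := hf
  set D := derivWithin f (Icc a b) with hDdef
  have hfD : ∀ t ∈ Ioo a b, HasDerivAt f (D t) t := fun t ht =>
    (hdiff t (Ioo_subset_Icc_self ht)).hasDerivWithinAt.hasDerivAt (Icc_mem_nhds ht.1 ht.2)
  have hderiv : ∀ t ∈ Ioo a b, deriv f t = D t := fun t ht => (hfD t ht).deriv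
  have hderiv2 : ∀ t ∈ Ioo a b, deriv (deriv f) t = deriv D t := by
    intro t ht
    refine EventuallyEq.deriv_eq ?_
    filter_upwards [Ioo_mem_nhds ht.1 ht.2] with s hs using hderiv s hs
  obtain ⟨qim, hpolar⟩ := hD.eq_norm_mul_exp hab.le hne
  have hDc : ContinuousOn D (Icc a b) := by
    have := hD.continuousOn
    rwa [uIcc_of_le hab.le] at this
  set k : ℝ → ℝ := fun t => signedCurvature f t * ‖deriv f t‖ with hk
  -- `conj D * D' = |D|² * (D' / D)`. Two-sided and one-sided derivatives agree only in the open
  -- interval, which is enough for the integrals.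
  have hkq : ∀ t ∈ Ioo a b, k t = (deriv D t / D t).im := by
    intro t ht
    have h0 : ‖D t‖ ≠ 0 := norm_ne_zero_iff.mpr (hne t (Ioo_subset_Icc_self ht))
    simp only [hk, signedCurvature, hderiv t ht, hderiv2 t ht]
    rw [div_eq_mul_inv (deriv D t), Complex.inv_def, ← mul_assoc, Complex.im_mul_ofReal,
      Complex.normSq_eq_norm_sq, mul_comm (deriv D t)]
    field_simp
  have hkint : IntervalIntegrable k volume a b := by
    refine qim.congr_ae ?_
    rw [EventuallyEq, ae_restrict_iff' measurableSet_uIoc]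
    filter_upwards [Measure.ae_ne volume b] with t htb ht
    rw [uIoc_of_le hab.le] at ht
    exact (hkq t ⟨ht.1, lt_of_le_of_ne ht.2 htb⟩).symm
  have hkeq : ∀ x ∈ Icc a b, ∫ t in a..x, k t = ∫ t in a..x, (deriv D t / D t).im := by
    intro x hx
    refine intervalIntegral.integral_congr_ae ?_
    filter_upwards [Measure.ae_ne volume b] with t htb ht
    rw [uIoc_of_le hx.1] at ht
    exact hkq t ⟨ht.1, lt_of_le_of_ne (ht.2.trans hx.2) htb⟩
  set θ : ℝ → ℝ := fun t => (D a).arg + ∫ x in a..t, k x with hθ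
  set v : ℝ → ℝ := fun t => ‖D t‖ with hv
  have hsub : ∀ x ∈ Icc a b, ∀ y ∈ Icc a b, uIcc x y ⊆ uIcc a b := fun x hx y hy => by
    rw [uIcc_of_le hab.le]
    exact uIcc_subset_Icc hx hy
  have hen : ∀ t ∈ Ioo a b, signedCurvature f t ^ 2 * ‖deriv f t‖ = k t ^ 2 / v t := by
    intro t ht
    have h0 : ‖D t‖ ≠ 0 := norm_ne_zero_iff.mpr (hne t (Ioo_subset_Icc_self ht))
    simp only [hk, hv, hderiv t ht]
    field_simp
  have hE : bendingEnergy f a b =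
      (1 / 4) * ∫⁻ t in Ioc a b, ENNReal.ofReal (k t ^ 2 / v t) := by
    rw [bendingEnergy, ← restrict_Ioo_eq_restrict_Icc, ← restrict_Ioo_eq_restrict_Ioc]
    congr 1
    exact setLIntegral_congr_fun measurableSet_Ioo fun t ht => by simp only [hen t ht]
  have hnn : ∀ t, 0 ≤ k t ^ 2 / v t := fun t => div_nonneg (sq_nonneg _) (norm_nonneg _)
  have hmeas : AEStronglyMeasurable (fun t => k t ^ 2 / v t) (volume.restrict (Ioc a b)) := by
    have m1 : AEMeasurable k (volume.restrict (Ioc a b)) := hkint.1.1.aemeasurable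
    have m2 : AEMeasurable v (volume.restrict (Ioc a b)) :=
      ((hDc.norm.mono Ioc_subset_Icc_self).aestronglyMeasurable measurableSet_Ioc).aemeasurable
    exact ((m1.pow_const 2).div m2).aestronglyMeasurable
  have hfin : ∫⁻ t in Ioc a b, ENNReal.ofReal (k t ^ 2 / v t) ≠ ⊤ := by
    intro htop
    rw [hE, htop] at he
    exact he (ENNReal.mul_top (by simp))
  have hint : IntegrableOn (fun t => k t ^ 2 / v t) (Ioc a b) :=
    (lintegral_ofReal_ne_top_iff_integrable hmeas (ae_of_all _ hnn)).mp hfin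
  refine ⟨θ, v, k, ⟨hDc.norm, fun t ht => norm_pos_iff.mpr (hne t ht), hkint,
    (intervalIntegrable_iff_integrableOn_Ioc_of_le hab.le).mpr hint, ?_, ?_⟩, ?_, fun t => rfl, ?_⟩
  · intro x hx y hy
    have ha := left_mem_Icc.mpr hab.le
    simp only [hθ, add_sub_add_left_eq_sub]
    exact intervalIntegral.integral_interval_sub_left (hkint.mono_set (hsub a ha y hy))
      (hkint.mono_set (hsub a ha x hx))
  · have key : ∀ x ∈ Icc a b, f x - f a = ∫ t in a..x, v t * Complex.exp (θ t * Complex.I) := by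
      intro x hx
      have h1 := intervalIntegral.integral_eq_sub_of_hasDerivAt_of_le hx.1
        (hdiff.continuousOn.mono (Icc_subset_Icc_right hx.2))
        (fun t ht => hfD t ⟨ht.1, ht.2.trans_le hx.2⟩)
        ((hDc.mono (Icc_subset_Icc_right hx.2)).intervalIntegrable_of_Icc hx.1)
      rw [← h1]
      refine intervalIntegral.integral_congr fun t ht => ?_
      rw [uIcc_of_le hx.1] at ht
      have ht' : t ∈ Icc a b := ⟨ht.1, ht.2.trans hx.2⟩
      have h2 := hpolar t ht'
      rw [← hkeq t ht'] at h2
      exact h2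
    have hi : IntervalIntegrable (fun t => (v t : ℂ) * Complex.exp (θ t * Complex.I)) volume a b := by
      refine (hDc.intervalIntegrable_of_Icc hab.le).congr fun t ht => ?_
      rw [uIoc_of_le hab.le] at ht
      have ht' := Ioc_subset_Icc_self ht
      have h2 := hpolar t ht'
      rw [← hkeq t ht'] at h2
      exact h2
    intro x hx y hy
    have ha := left_mem_Icc.mpr hab.le
    rw [← intervalIntegral.integral_interval_sub_left (hi.mono_set (hsub a ha y hy))
      (hi.mono_set (hsub a ha x hx)), ← key x hx, ← key y hy]
    ring
  · simp only [hθ, intervalIntegral.integral_same, add_zero]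
    exact ⟨(Complex.neg_pi_lt_arg _).le, Complex.arg_le_pi _⟩
  · rw [hE, intervalIntegral.integral_of_le hab.le,
      ofReal_integral_eq_lintegral_ofReal hint (ae_of_all _ hnn)]

theorem IsPolarCurve.isPiece_of_isSCurve {f : ℝ → ℂ} {θ v k : ℝ → ℝ} {a b x y : ℝ}
    (h : IsPolarCurve f θ v k a b) (hk : ∀ t, k t = signedCurvature f t * ‖deriv f t‖)
    (hx : x ∈ Icc a b) (hy : y ∈ Icc a b) (hxy : x ≤ y) (hs : IsSCurve f x y) :
    IsPiece (f y - f x) (θ x) (θ y) (∫ t in x..y, k t ^ 2 / v t) := by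
  have hturn : ∀ s t, turningAngle f s t = ∫ r in s..t, k r := fun s t => by
    simp only [turningAngle, hk]
  have hpi : |(0 : ℝ)| ≤ Real.pi := by simpa using Real.pi_pos.le
  have hleft : ∀ s t, IsLeftCCurve f s t →
      (∀ᵐ r, r ∈ Ioo s t → 0 ≤ k r) ∧ |∫ r in s..t, k r| ≤ Real.pi := by
    intro s t hc
    refine ⟨?_, by rw [← hturn]; exact hc.2⟩
    filter_upwards [(ae_restrict_iff' measurableSet_Icc).mp hc.1.2] with r hr hr'
    rw [hk]
    exact mul_nonneg (hr (Ioo_subset_Icc_self hr')) (norm_nonneg _)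
  have hright : ∀ s t, IsRightCCurve f s t →
      (∀ᵐ r, r ∈ Ioo s t → k r ≤ 0) ∧ |∫ r in s..t, k r| ≤ Real.pi := by
    intro s t hc
    refine ⟨?_, by rw [← hturn]; exact hc.2⟩
    filter_upwards [(ae_restrict_iff' measurableSet_Icc).mp hc.1.2] with r hr hr'
    rw [hk]
    exact mul_nonpos_of_nonpos_of_nonneg (hr (Ioo_subset_Icc_self hr')) (norm_nonneg _)
  rcases hs with (hc | hc) | ⟨-, c, hc, ⟨h1, h2⟩ | ⟨h1, h2⟩⟩
  -- A single c-curve is treated as having its change of sign at `y`, with an empty second part.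
  · obtain ⟨h1, h2⟩ := hleft _ _ hc
    exact h.isPiece hx hy (right_mem_Icc.mpr hxy) h2
      (by simpa using hpi) (Or.inl ⟨h1, by simp⟩)
  · obtain ⟨h1, h2⟩ := hright _ _ hc
    exact h.isPiece hx hy (right_mem_Icc.mpr hxy) h2
      (by simpa using hpi) (Or.inr ⟨h1, by simp⟩)
  · obtain ⟨h3, h4⟩ := hleft _ _ h1
    obtain ⟨h5, h6⟩ := hright _ _ h2
    exact h.isPiece hx hy (Ioo_subset_Icc_self hc) h4 h6 (Or.inl ⟨h3, h5⟩)
  · obtain ⟨h3, h4⟩ := hright _ _ h1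
    obtain ⟨h5, h6⟩ := hleft _ _ h2
    exact h.isPiece hx hy (Ioo_subset_Icc_self hc) h4 h6 (Or.inr ⟨h3, h5⟩)

/-! ### Compactness of chains and the minimizer -/

/-- The chains of tangent angles and energies of s-shaped pieces through the points `P`, with
initial angle of size at most `B`. -/
def chains {m : ℕ} (P : Fin (m + 1) → ℂ) (B : ℝ) : Set ((Fin (m + 1) → ℝ) × (Fin m → ℝ)) :=
  {x | |x.1 0| ≤ B ∧
    ∀ i : Fin m, IsPiece (P i.succ - P i.castSucc) (x.1 i.castSucc) (x.1 i.succ) (x.2 i)}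

theorem isClosed_chains {m : ℕ} (P : Fin (m + 1) → ℂ) (B : ℝ) : IsClosed (chains P B) := by
  refine IsSeqClosed.isClosed fun x x₀ hx hlim => ?_
  have h1 : ∀ i, Tendsto (fun n => (x n).1 i) atTop (𝓝 (x₀.1 i)) := fun i =>
    ((continuous_apply i).comp continuous_fst).continuousAt.tendsto.comp hlim
  have h2 : ∀ i, Tendsto (fun n => (x n).2 i) atTop (𝓝 (x₀.2 i)) := fun i =>
    ((continuous_apply i).comp continuous_snd).continuousAt.tendsto.comp hlim
  exact ⟨le_of_tendsto' (h1 0).abs fun n => (hx n).1,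
    fun i => IsPiece.of_tendsto (fun n => (hx n).2 i) (h1 _) (h1 _) (h2 _)⟩

theorem abs_angle_le_of_mem_chains {m : ℕ} {P : Fin (m + 1) → ℂ} {B : ℝ}
    {x : (Fin (m + 1) → ℝ) × (Fin m → ℝ)} (hx : x ∈ chains P B) (i : Fin (m + 1)) :
    |x.1 i| ≤ B + m * Real.pi := by
  have key : ∀ i : Fin (m + 1), |x.1 i| ≤ B + i * Real.pi := by
    intro i
    induction i using Fin.induction with
    | zero => simpa using hx.1
    | succ i ih =>
      have h1 := (hx.2 i).abs_sub_le
      have h2 := abs_sub_abs_le_abs_sub (x.1 i.succ) (x.1 i.castSucc)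
      simp only [Fin.val_castSucc, Fin.val_succ, Nat.cast_add, Nat.cast_one] at ih ⊢
      linarith
  refine (key i).trans ?_
  have : (i : ℝ) ≤ m := by exact_mod_cast Nat.lt_succ_iff.mp i.2
  have := Real.pi_pos
  gcongr

/-- Angles are bounded because each piece changes them by at most `π`; energies are bounded because
they are nonnegative with bounded sum. -/
theorem isCompact_chains_inter {m : ℕ} (P : Fin (m + 1) → ℂ) (B E : ℝ) :
    IsCompact (chains P B ∩ {x | ∑ i, x.2 i ≤ E}) := by
  refine Metric.isCompact_of_isClosed_isBounded
    ((isClosed_chains P B).inter (isClosed_le (by fun_prop) continuous_const)) ?_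
  refine (Metric.isBounded_closedBall (x := 0) (r := max (B + m * Real.pi) E)).subset ?_
  rintro x ⟨hx, hE⟩
  have hB : 0 ≤ B := (abs_nonneg _).trans hx.1
  have h0 : 0 ≤ max (B + m * Real.pi) E :=
    le_max_of_le_left (add_nonneg hB (by positivity))
  have hnn : ∀ i, 0 ≤ x.2 i := fun i => (hx.2 i).energy_nonneg
  rw [mem_closedBall_zero_iff, Prod.norm_def, sup_le_iff, pi_norm_le_iff_of_nonneg h0,
    pi_norm_le_iff_of_nonneg h0]
  refine ⟨fun i => (abs_angle_le_of_mem_chains hx i).trans (le_max_left _ _), fun i => ?_⟩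
  rw [Real.norm_of_nonneg (hnn i)]
  exact ((Finset.single_le_sum (fun j _ => hnn j) (Finset.mem_univ i)).trans hE).trans
    (le_max_right _ _)

/-- The chain of an admissible curve of finite bending energy. -/
theorem IsAdmissible.exists_mem_chains {m : ℕ} {P : Fin (m + 1) → ℂ} {B : ℝ} (hB : Real.pi ≤ B)
    {g : ℝ → ℂ} {a b : ℝ} (hg : IsAdmissible P g a b) (he : bendingEnergy g a b ≠ ⊤) :
    ∃ x ∈ chains P B, bendingEnergy g a b = (1 / 4) * ENNReal.ofReal (∑ i, x.2 i) := by
  obtain ⟨hcurve, t, ht, hta, htb, htP, hs⟩ := hg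
  obtain ⟨θ, v, k, hpc, hθ, hk, hE⟩ := hcurve.isPolarCurve he
  have ht0 : t 0 = a := hta 0 rfl
  have htl : t (Fin.last m) = b := htb _ rfl
  have htm : ∀ i, t i ∈ Icc a b := fun i =>
    ⟨ht0 ▸ ht.monotone (Fin.zero_le i), htl ▸ ht.monotone (Fin.le_last i)⟩
  refine ⟨(fun i => θ (t i), fun i => ∫ s in (t i.castSucc)..(t i.succ), k s ^ 2 / v s),
    ⟨?_, fun i => ?_⟩, ?_⟩
  · simp only [ht0]
    exact (abs_le.mpr hθ).trans hB
  · rw [← htP, ← htP]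
    exact hpc.isPiece_of_isSCurve hk (htm _) (htm _) (ht.monotone i.castSucc_lt_succ.le)
      (hs _ _ (by simp))
  · rw [hE]
    congr 2
    set G : ℝ → ℝ := fun x => ∫ s in a..x, k s ^ 2 / v s with hG
    have hGd : ∀ i : Fin m, ∫ s in (t i.castSucc)..(t i.succ), k s ^ 2 / v s =
        G (t i.succ) - G (t i.castSucc) := by
      intro i
      have hi : ∀ j, IntervalIntegrable (fun s => k s ^ 2 / v s) volume a (t j) := fun j =>
        (hpc.mono (left_mem_Icc.mpr ((htm 0).1.trans (htm 0).2)) (htm j) (htm j).1).integrable_energy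
      exact (intervalIntegral.integral_interval_sub_left (hi _) (hi _)).symm
    simp only [hGd]
    rw [Finset.sum_sub_distrib]
    have h1 := Fin.sum_univ_succ fun i => G (t i)
    have h2 := Fin.sum_univ_castSucc fun i => G (t i)
    have h3 : G (t 0) = 0 := by simp [hG, ht0]
    have h4 : G (t (Fin.last m)) = ∫ s in a..b, k s ^ 2 / v s := by rw [htl]
    linarith

theorem theorem1p1 (n : ℕ) (hn : 2 ≤ n) (P : Fin n → ℂ)
    (hP : ∀ i j : Fin n, (j : ℕ) = (i : ℕ) + 1 → P i ≠ P j) :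
    ∃ (f : ℝ → ℂ) (a b : ℝ), IsAdmissible P f a b ∧ bendingEnergy f a b < ⊤ ∧
      ∀ (g : ℝ → ℂ) (c d : ℝ), IsAdmissible P g c d → bendingEnergy f a b ≤ bendingEnergy g c d := by
  obtain ⟨m, rfl⟩ : ∃ m, n = m + 1 := ⟨n - 1, by omega⟩
  have hP' : ∀ i : Fin m, P i.castSucc ≠ P i.succ := fun i => hP _ _ (by simp)
  obtain ⟨γ, hγ⟩ := exists_generic_angle (fun i : Fin m => P i.succ - P i.castSucc)
    fun i => sub_ne_zero.mpr (hP' i).symm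
  -- Prescribing the direction `γ` at every node gives a chain of finite energy.
  choose e₀ he₀ using fun i => exists_isPiece (hγ i)
  -- Large enough for the starting chain and for the normalized chain of every competitor.
  set B := max Real.pi |γ| with hB
  have hmem : ((fun _ => γ, e₀) : (Fin (m + 1) → ℝ) × (Fin m → ℝ)) ∈ chains P B :=
    ⟨le_max_right _ _, he₀⟩
  obtain ⟨x, ⟨hx, hxE⟩, hmin⟩ := (isCompact_chains_inter P B (∑ i, e₀ i)).exists_isMinOn
    ⟨_, hmem, le_refl (∑ i, e₀ i)⟩
    (by fun_prop : Continuous fun x : (Fin (m + 1) → ℝ) × (Fin m → ℝ) => ∑ i, x.2 i).continuousOn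
  obtain ⟨f, a, b, hf, hfE⟩ := exists_isAdmissible_of_chain (by omega) P hP' x.1 x.2 hx.2
  refine ⟨f, a, b, hf, hfE.trans_lt (ENNReal.mul_lt_top (by simp) ENNReal.ofReal_lt_top), ?_⟩
  intro g c d hg
  by_cases hgE : bendingEnergy g c d = ⊤
  · rw [hgE]
    exact le_top
  obtain ⟨y, hy, hyE⟩ := hg.exists_mem_chains (B := B) (le_max_left _ _) hgE
  rw [hyE]
  refine hfE.trans (mul_le_mul_right (ENNReal.ofReal_le_ofReal ?_) _)
  -- A competitor above the starting energy lies outside the compact set, but then the minimum is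
  -- below it anyway.
  rcases le_total (∑ i, y.2 i) (∑ i, e₀ i) with h | h
  · exact hmin ⟨hy, h⟩
  · exact hxE.trans h
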